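/- Let $V,H$ be real Hilbert spaces such that $V\hookrightarrow H\cong H^*\hookrightarrow V^*$ is a Gelfand triple, where $V\hookrightarrow H$ is continuous, dense and compact. Let $a\colon V\times V\to\mathbb R$ be a continuous bilinear form for which there are $\alpha_0>0$, $\omega_0\ge 0$ with $$a(v,v)+\omega_0\|v\|_H^2\ \ge\ \alpha_0\|v\|_V^2\qquad\text{for all } v\in V,$$ and let $A\colon V\to V^*$ be given by $\langle Av,w\rangle=a(v,w)$. Let $(\omega,\varrho)$ be a measure space, $B\colon L^2(\omega,\varrho)\to V^*$ linear and continuous, $y_0,y_d\in H$ and $\delta_0>0$. Let $u_a,u_b\in L^\infty(\omega,\varrho)$ with $u_a<u_b$ almost everywhere, put $$U_{ad}=\{u\in L^2(\omega,\varrho): u_a\le u\le u_b \text{ a.e. in }\omega\},$$ and assume that $U_{ad}$ is bounded in $L^2(\omega,\varrho)$ (which is automatic if $\varrho(\omega)<\infty$). For $T>0$ let $$U_{ad}(0,T)=\{u\in L^2((0,T);L^2(\omega,\varrho)): u(t)\in U_{ad}\text{ for a.e. }t\in(0,T)\},$$ and for $u\in U_{ad}(0,T)$ let $y[u]\in H^1((0,T);V^*)\cap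 L^2((0,T);V)\subset C([0,T];H)$ be the solution of $$\partial_t y+Ay=Bu\ \text{ in }(0,T),\qquad y(0)=y_0 .$$ Assume that there are $T>0$ and $u\in U_{ad}(0,T)$ with $\|y[u](T)-y_d\|_H\le\delta_0$, and that $\|y_0-y_d\|_H>\delta_0$. For $\delta\ge 0$ let $$T(\delta)=\inf\{T>0:\ \text{there is } u\in U_{ad}(0,T)\text{ with } \|y[u](T)-y_d\|_H\le\delta_0+\delta\},$$ and set $\delta^\bullet=\|y_0-y_d\|_H-\delta_0$. Then $T(\delta)<\infty$ for all $\delta\in[0,\delta^\bullet]$, and the function $T\colon[0,\delta^\bullet]\to[0,\infty)$ is strictly monotonically decreasing and right-continuous. -/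

import Mathlib

open MeasureTheory Set
open scoped ENNReal

namespace TimeOptimal

noncomputable section

/-- The embedding `H ≅ H* ↪ V*` of a Gelfand triple `V ↪ H ↪ V*` with `ι : V ↪ H`:
the element `h` acts on `V` by `v ↦ (h, ι v)_H`. -/
def toDual {V H : Type*} [NormedAddCommGroup V] [InnerProductSpace ℝ V]
    [NormedAddCommGroup H] [InnerProductSpace ℝ H]
    (ι : V →L[ℝ] H) (h : H) : StrongDual ℝ V :=
  (innerSL ℝ h).comp ι

/-- `g` is the weak (distributional) derivative of `f` on `(0,T)`, with values in `E`. -/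
def HasWeakDerivOn {E : Type*} [NormedAddCommGroup E] [NormedSpace ℝ E]
    (T : ℝ) (f g : ℝ → E) : Prop :=
  ∀ φ : ℝ → ℝ, ContDiff ℝ (⊤ : ℕ∞) φ → HasCompactSupport φ → tsupport φ ⊆ Ioo 0 T →
    ∫ t in Ioo 0 T, deriv φ t • f t = - ∫ t in Ioo 0 T, φ t • g t

/-- `v` belongs to `W(0,T) = H¹((0,T); V*) ∩ L²((0,T); V)` and has weak derivative `g` in
`L²((0,T); V*)`. (That `v` is in `L²((0,T); V*)` follows from `v ∈ L²((0,T); V)`.) -/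
structure MemW {V H : Type*} [NormedAddCommGroup V] [InnerProductSpace ℝ V]
    [NormedAddCommGroup H] [InnerProductSpace ℝ H]
    (ι : V →L[ℝ] H) (T : ℝ) (v : ℝ → V) (g : ℝ → StrongDual ℝ V) : Prop where
  memLp : MemLp v 2 (volume.restrict (Ioo 0 T))
  memLp_deriv : MemLp g 2 (volume.restrict (Ioo 0 T))
  hasWeakDeriv : HasWeakDerivOn T (fun t => toDual ι (ι (v t))) g

/-- The admissible control values
`U_ad = {u ∈ L²(ω) : u_a ≤ u ≤ u_b almost everywhere in ω}`. -/
def Uad {ω : Type*} [MeasurableSpace ω] {ϱ : Measure ω} (ua ub : Lp ℝ ⊤ ϱ) :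
    Set (Lp ℝ 2 ϱ) :=
  {u | ∀ᵐ x ∂ϱ, ua x ≤ u x ∧ u x ≤ ub x}

/-- The admissible controls
`U_ad(0,T) = {u ∈ L²((0,T); L²(ω)) : u(t) ∈ U_ad for almost every t ∈ (0,T)}`
(functions on `ℝ` of which only the values on `(0,T)` matter). -/
def UadOn {ω : Type*} [MeasurableSpace ω] {ϱ : Measure ω} (ua ub : Lp ℝ ⊤ ϱ) (T : ℝ) :
    Set (ℝ → Lp ℝ 2 ϱ) :=
  {u | MemLp u 2 (volume.restrict (Ioo 0 T)) ∧
    ∀ᵐ t ∂(volume.restrict (Ioo 0 T)), u t ∈ Uad ua ub}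

/-- `y` is the state associated with the control `u` on `(0,T)`, i.e. the continuous representative
`[0,T] → H` of the solution `v ∈ W(0,T)` of `∂ₜ v + A v = B u` in `(0,T)`, `v(0) = y₀`. The
operator `A : V → V*` is the one with `⟨A v, w⟩ = a(v,w)`, so `A v` is `a v`. -/
def IsState {V H ω : Type*} [NormedAddCommGroup V] [InnerProductSpace ℝ V]
    [NormedAddCommGroup H] [InnerProductSpace ℝ H] [MeasurableSpace ω] {ϱ : Measure ω}
    (ι : V →L[ℝ] H) (a : V →L[ℝ] V →L[ℝ] ℝ) (B : Lp ℝ 2 ϱ →L[ℝ] StrongDual ℝ V)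
    (y₀ : H) (T : ℝ) (u : ℝ → Lp ℝ 2 ϱ) (y : ℝ → H) : Prop :=
  ContinuousOn y (Icc 0 T) ∧ y 0 = y₀ ∧
    ∃ (v : ℝ → V) (g : ℝ → StrongDual ℝ V), MemW ι T v g ∧
      (∀ᵐ t ∂(volume.restrict (Ioo 0 T)), y t = ι (v t)) ∧
      (∀ᵐ t ∂(volume.restrict (Ioo 0 T)), g t + a (v t) = B (u t))

/-- The times `T > 0` at which some admissible control steers the state from `y₀` into the closed
ball of radius `r` around `y_d`. -/
def feasibleTimes {V H ω : Type*} [NormedAddCommGroup V] [InnerProductSpace ℝ V]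
    [NormedAddCommGroup H] [InnerProductSpace ℝ H] [MeasurableSpace ω] {ϱ : Measure ω}
    (ι : V →L[ℝ] H) (a : V →L[ℝ] V →L[ℝ] ℝ) (B : Lp ℝ 2 ϱ →L[ℝ] StrongDual ℝ V)
    (ua ub : Lp ℝ ⊤ ϱ) (y₀ y_d : H) (r : ℝ) : Set ℝ :=
  {T | 0 < T ∧ ∃ u ∈ UadOn ua ub T, ∃ y, IsState ι a B y₀ T u y ∧ ‖y T - y_d‖ ≤ r}

/-- The minimal-time value function `δ ↦ T(δ) ∈ [0,∞]`: the infimum of the times `T > 0` such that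
`‖y[u](T) - y_d‖ ≤ δ₀ + δ` for some `u ∈ U_ad(0,T)`. -/
def minTime {V H ω : Type*} [NormedAddCommGroup V] [InnerProductSpace ℝ V]
    [NormedAddCommGroup H] [InnerProductSpace ℝ H] [MeasurableSpace ω] {ϱ : Measure ω}
    (ι : V →L[ℝ] H) (a : V →L[ℝ] V →L[ℝ] ℝ) (B : Lp ℝ 2 ϱ →L[ℝ] StrongDual ℝ V)
    (ua ub : Lp ℝ ⊤ ϱ) (y₀ y_d : H) (δ₀ δ : ℝ) : ℝ≥0∞ :=
  ⨅ T ∈ feasibleTimes ι a B ua ub y₀ y_d (δ₀ + δ), ENNReal.ofReal T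

end

end TimeOptimal

/-! Strict monotonicity: let `δ < δ' ≤ δ•`. The ball of radius `δ₀ + δ` does not contain `y₀`, and
the time `T(δ)` is attained. The optimal state is continuous into `H`, so it lies in the larger ball
of radius `δ₀ + δ'` already shortly before `T(δ)`; the same control on the shorter interval shows
`T(δ') < T(δ)`.

Right-continuity: by monotonicity only lower semicontinuity from the right is at stake. If it
failed, there would be times bounded by some `τ < T(δ)` at which balls with radii tending to `δ₀ +
δ` are reached, and a limit of such times would contradict the minimality of `T(δ)`.

Both attainment and semicontinuity follow from one closedness statement,
`mem_feasibleTimes_of_tendsto`: if `r n → r`, `T n → T` and the radius `r n` is reachable at time `T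
n`, then `r` is reachable at `T`, unless `T = 0` and `y₀` itself lies in the limit ball. The Gårding
inequality and Gronwall's lemma bound the states in `L²(V)`. A weak limit of states, controls and
terminal values satisfies every condition that is closed and convex: the control constraint, the
integrated state equation, the terminal condition and the target inequality.

Such an argument needs the state equation in integrated form and the energy identity. Both come from
the embedding of `W(0,T)` into `C([0,T]; H)`, which is proved by approximation with moving averages
(`exists_continuous_representative`), after du Bois-Reymond's lemma has turned weak derivatives into
primitives. -/

namespace TimeOptimal

/-! ### Weak derivatives and primitives on an interval -/

section WeakDerivative

variable {E : Type*} [NormedAddCommGroup E] [NormedSpace ℝ E] [CompleteSpace E]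

/-- Integration by parts against the primitive of an integrable function. -/
lemma integral_deriv_smul_primitive {T : ℝ} (hT : 0 ≤ T) {g : ℝ → E}
    (hg : IntervalIntegrable g volume 0 T) {φ : ℝ → ℝ} (hφ : ContDiff ℝ 1 φ) (hφT : φ T = 0) :
    ∫ t in 0..T, deriv φ t • ∫ s in 0..t, g s = - ∫ t in 0..T, φ t • g t := by
  have hφ' : Continuous (deriv φ) := hφ.continuous_deriv le_rfl
  have hg' : Integrable g (volume.restrict (Ioc 0 T)) :=
    (intervalIntegrable_iff_integrableOn_Ioc_of_le hT).1 hg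
  -- Fubini on the triangle `s ≤ t`: integrating out `s` produces the primitive of `g`, integrating
  -- out `t` produces `φ T - φ s = -φ s`.
  set F : ℝ → ℝ → E := fun t s => {p : ℝ × ℝ | p.2 ≤ p.1}.indicator
    (fun p => deriv φ p.1 • g p.2) (t, s) with hF
  have hm : MeasurableSet {p : ℝ × ℝ | p.2 ≤ p.1} := measurableSet_le measurable_snd measurable_fst
  have hint : Integrable (Function.uncurry F)
      ((volume.restrict (Ioc 0 T)).prod (volume.restrict (Ioc 0 T))) := by
    have : Integrable (deriv φ) (volume.restrict (Ioc 0 T)) :=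
      (hφ'.integrableOn_Icc).mono_set Ioc_subset_Icc_self
    exact (this.smul_prod hg').indicator hm
  have hswap := integral_integral_swap hint
  have h1 : ∀ t ∈ Ioc 0 T, ∫ s in Ioc 0 T, F t s = deriv φ t • ∫ s in 0..t, g s := by
    intro t ht
    have : ∀ s, F t s = (Iic t).indicator (fun s => deriv φ t • g s) s := by
      intro s
      by_cases hs : s ≤ t <;> simp [hF, indicator, hs]
    simp_rw [this]
    rw [setIntegral_indicator measurableSet_Iic, integral_smul,
      intervalIntegral.integral_of_le ht.1.le]
    congr 3
    ext s
    simp only [mem_inter_iff, mem_Ioc, mem_Iic]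
    constructor
    · rintro ⟨h, h'⟩; exact ⟨h.1, h'⟩
    · rintro ⟨h, h'⟩; exact ⟨⟨h, h'.trans ht.2⟩, h'⟩
  have h2 : ∀ s ∈ Ioc 0 T, ∫ t in Ioc 0 T, F t s = - (φ s • g s) := by
    intro s hs
    have : ∀ t, F t s = (Ici s).indicator (fun t => deriv φ t • g s) t := by
      intro t
      by_cases hs : s ≤ t <;> simp [hF, indicator, hs]
    simp_rw [this]
    rw [setIntegral_indicator measurableSet_Ici, integral_smul_const]
    have hset : Ioc 0 T ∩ Ici s = Icc s T := by
      ext t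
      simp only [mem_inter_iff, mem_Ioc, mem_Ici, mem_Icc]
      constructor
      · rintro ⟨h, h'⟩; exact ⟨h', h.2⟩
      · rintro ⟨h, h'⟩; exact ⟨⟨hs.1.trans_le h, h'⟩, h⟩
    rw [hset, integral_Icc_eq_integral_Ioc, ← intervalIntegral.integral_of_le hs.2,
      intervalIntegral.integral_deriv_eq_sub
        (fun x _ => (hφ.differentiable one_ne_zero).differentiableAt)
        (hφ'.intervalIntegrable _ _), hφT]
    simp
  rw [setIntegral_congr_fun measurableSet_Ioc h1, setIntegral_congr_fun measurableSet_Ioc h2,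
    integral_neg] at hswap
  rwa [intervalIntegral.integral_of_le hT, intervalIntegral.integral_of_le hT]

lemma eq_zero_of_tsupport_subset {T t : ℝ} {φ : ℝ → ℝ} (h : tsupport φ ⊆ Ioo 0 T)
    (ht : t ∉ Ioo 0 T) : φ t = 0 :=
  image_eq_zero_of_notMem_tsupport fun h' => ht (h h')

/-- A function that is almost everywhere a primitive of `g` has weak derivative `g`. -/
lemma HasWeakDerivOn.of_ae_eq_primitive {T : ℝ} (hT : 0 ≤ T) {f g : ℝ → E} {c : E}
    (hg : IntervalIntegrable g volume 0 T)
    (hf : ∀ᵐ t ∂(volume.restrict (Ioo 0 T)), f t = c + ∫ s in 0..t, g s) :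
    HasWeakDerivOn T f g := by
  intro φ hφ _ hsupp
  have hφ1 : ContDiff ℝ 1 φ := hφ.of_le (by exact_mod_cast le_top)
  have hφ' : Continuous (deriv φ) := hφ1.continuous_deriv le_rfl
  have hφ0 : φ 0 = 0 := eq_zero_of_tsupport_subset hsupp (by simp)
  have hφT : φ T = 0 := eq_zero_of_tsupport_subset hsupp (by simp)
  have hG : ContinuousOn (fun t => ∫ s in 0..t, g s) (uIcc 0 T) :=
    intervalIntegral.continuousOn_primitive_interval' hg (by simp)
  calc ∫ t in Ioo 0 T, deriv φ t • f t
      = ∫ t in Ioo 0 T, deriv φ t • (c + ∫ s in 0..t, g s) := by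
        apply integral_congr_ae
        filter_upwards [hf] with t ht
        rw [ht]
    _ = ∫ t in 0..T, (deriv φ t • c + deriv φ t • ∫ s in 0..t, g s) := by
        rw [intervalIntegral.integral_of_le hT, integral_Ioc_eq_integral_Ioo]
        simp_rw [smul_add]
    _ = - ∫ t in 0..T, φ t • g t := by
        rw [intervalIntegral.integral_add, integral_deriv_smul_primitive hT hg hφ1 hφT]
        · have : ∫ t in 0..T, deriv φ t • c = 0 := by
            rw [intervalIntegral.integral_smul_const, intervalIntegral.integral_deriv_eq_sub
              (fun x _ => (hφ1.differentiable one_ne_zero).differentiableAt)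
              (hφ'.intervalIntegrable _ _), hφ0, hφT]
            simp
          rw [this, zero_add]
        · exact (by fun_prop : Continuous fun t => deriv φ t • c).intervalIntegrable _ _
        · exact (hφ'.continuousOn.smul hG).intervalIntegrable
    _ = - ∫ t in Ioo 0 T, φ t • g t := by
        rw [intervalIntegral.integral_of_le hT, integral_Ioc_eq_integral_Ioo]

lemma exists_Icc_of_isCompact_subset_Ioo {T : ℝ} {K : Set ℝ} (hK : IsCompact K)
    (hKT : K ⊆ Ioo 0 T) (hT : 0 < T) : ∃ a b, 0 < a ∧ a ≤ b ∧ b < T ∧ K ⊆ Icc a b := by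
  rcases K.eq_empty_or_nonempty with rfl | hne
  · exact ⟨T / 2, T / 2, by linarith, le_rfl, by linarith, empty_subset _⟩
  · obtain ⟨a, ha, ha'⟩ := hK.exists_isLeast hne
    obtain ⟨b, hb, hb'⟩ := hK.exists_isGreatest hne
    exact ⟨a, b, (hKT ha).1, ha' hb, (hKT hb).2, fun x hx => ⟨ha' hx, hb' hx⟩⟩

/-- A test function with vanishing integral is the derivative of a test function. -/
lemma exists_test_primitive {T : ℝ} (hT : 0 < T) {θ : ℝ → ℝ} (hθ : ContDiff ℝ (⊤ : ℕ∞) θ)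
    (hc : HasCompactSupport θ) (hsupp : tsupport θ ⊆ Ioo 0 T) (hint : ∫ t, θ t = 0) :
    ∃ φ : ℝ → ℝ, ContDiff ℝ (⊤ : ℕ∞) φ ∧ HasCompactSupport φ ∧ tsupport φ ⊆ Ioo 0 T ∧
      deriv φ = θ := by
  obtain ⟨a, b, ha, hab, hb, hK⟩ := exists_Icc_of_isCompact_subset_Ioo hc hsupp hT
  have hzero : ∀ t, t ∉ Icc a b → θ t = 0 := fun t ht =>
    image_eq_zero_of_notMem_tsupport fun h' => ht (hK h')
  -- Left of `a` this primitive vanishes because `θ` does; right of `b` it equals the full integral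
  -- of `θ`, which is zero.
  set φ : ℝ → ℝ := fun t => ∫ s in a..t, θ s with hφ
  have hd : ∀ t, HasDerivAt φ (θ t) t := fun t =>
    intervalIntegral.integral_hasDerivAt_right (hθ.continuous.intervalIntegrable _ _)
      (hθ.continuous.stronglyMeasurableAtFilter _ _) hθ.continuous.continuousAt
  have hderiv : deriv φ = θ := funext fun t => (hd t).deriv
  have hφsupp : Function.support φ ⊆ Icc a b := by
    intro t ht
    by_contra hn
    apply ht
    rcases lt_or_ge t a with h | h
    · have : ∫ s in a..t, θ s = ∫ s in a..t, (0 : ℝ) := by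
        apply intervalIntegral.integral_congr_ae
        have hne : ∀ᵐ s : ℝ, s ≠ a := by simp [ae_iff]
        filter_upwards [hne] with s hsa hs
        rw [uIoc_of_ge h.le] at hs
        exact hzero s fun h' => hsa (le_antisymm hs.2 h'.1)
      simp [hφ, this]
    · have hbt : b < t := by
        by_contra hbt
        exact hn ⟨h, not_lt.1 hbt⟩
      rw [← hint]
      simp only [hφ]
      rw [intervalIntegral.integral_of_le h, ← integral_Icc_eq_integral_Ioc]
      apply setIntegral_eq_integral_of_forall_compl_eq_zero
      intro s hs
      exact hzero s fun h' => hs ⟨h'.1, h'.2.trans hbt.le⟩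
  have hts : tsupport φ ⊆ Icc a b := closure_minimal hφsupp isClosed_Icc
  refine ⟨φ, ?_, isCompact_Icc.of_isClosed_subset (isClosed_tsupport _) hts,
    hts.trans fun x hx => ⟨ha.trans_le hx.1, hx.2.trans_lt hb⟩, hderiv⟩
  rw [contDiff_infty_iff_deriv]
  exact ⟨fun t => (hd t).differentiableAt, by rwa [hderiv]⟩

lemma exists_test_integral_eq_one {T : ℝ} (hT : 0 < T) :
    ∃ ψ : ℝ → ℝ, ContDiff ℝ (⊤ : ℕ∞) ψ ∧ HasCompactSupport ψ ∧ tsupport ψ ⊆ Ioo 0 T ∧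
      ∫ t, ψ t = 1 := by
  let f : ContDiffBump (T / 2) := ⟨T / 8, T / 4, by positivity, by linarith⟩
  refine ⟨f.normed volume, f.contDiff_normed, f.hasCompactSupport_normed, ?_,
    f.integral_normed⟩
  rw [f.tsupport_normed_eq]
  intro x hx
  rw [Real.closedBall_eq_Icc] at hx
  have h1 := hx.1
  have h2 := hx.2
  change T / 2 - T / 4 ≤ x at h1
  change x ≤ T / 2 + T / 4 at h2
  constructor <;> linarith

/-- The lemma of du Bois-Reymond: a function with weak derivative `g` is almost everywhere
a primitive of `g`. -/
lemma HasWeakDerivOn.ae_eq_primitive {T : ℝ} (hT : 0 < T) {f g : ℝ → E}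
    (hf : IntervalIntegrable f volume 0 T) (hg : IntervalIntegrable g volume 0 T)
    (h : HasWeakDerivOn T f g) :
    ∃ c, ∀ᵐ t ∂(volume.restrict (Ioo 0 T)), f t = c + ∫ s in 0..t, g s := by
  obtain ⟨ψ, hψ, hψc, hψs, hψ1⟩ := exists_test_integral_eq_one hT
  set F : ℝ → E := fun t => f t - ∫ s in 0..t, g s with hF
  have hGc : ContinuousOn (fun t => ∫ s in 0..t, g s) (uIcc 0 T) :=
    intervalIntegral.continuousOn_primitive_interval' hg (by simp)
  have hFi' : IntervalIntegrable F volume 0 T := hf.sub hGc.intervalIntegrable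
  have hFi : IntegrableOn F (Ioo 0 T) := by
    rwa [← intervalIntegrable_iff_integrableOn_Ioo_of_le hT.le]
  have hfi : IntegrableOn f (Ioo 0 T) := by
    rwa [← intervalIntegrable_iff_integrableOn_Ioo_of_le hT.le]
  have hGi : IntegrableOn (fun t => ∫ s in 0..t, g s) (Ioo 0 T) := by
    rw [← intervalIntegrable_iff_integrableOn_Ioo_of_le hT.le]
    exact hGc.intervalIntegrable
  have hmul : ∀ {θ : ℝ → ℝ} {k : ℝ → E}, Continuous θ → HasCompactSupport θ →
      IntegrableOn k (Ioo 0 T) → IntegrableOn (fun t => θ t • k t) (Ioo 0 T) := by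
    intro θ k hθ hθc hk
    obtain ⟨C, hC⟩ := hθc.exists_bound_of_continuous hθ
    exact Integrable.bdd_smul hk C hθ.aestronglyMeasurable (ae_of_all _ hC)
  have hF0 : ∀ φ : ℝ → ℝ, ContDiff ℝ (⊤ : ℕ∞) φ → HasCompactSupport φ → tsupport φ ⊆ Ioo 0 T →
      ∫ t in Ioo 0 T, deriv φ t • F t = 0 := by
    intro φ hφ hφc hφs
    have hd : Continuous (deriv φ) :=
      (hφ.of_le (by exact_mod_cast le_top : (1 : WithTop ℕ∞) ≤ ((⊤ : ℕ∞) : WithTop ℕ∞))).continuous_deriv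
        le_rfl
    have e1 := h φ hφ hφc hφs
    have e2 := HasWeakDerivOn.of_ae_eq_primitive (f := fun t => ∫ s in 0..t, g s) (c := 0) hT.le hg
      (ae_of_all _ fun t => (zero_add _).symm) φ hφ hφc hφs
    simp only [hF, smul_sub]
    rw [integral_sub (hmul hd hφc.deriv hfi) (hmul hd hφc.deriv hGi), e1, e2, sub_self]
  set c : E := ∫ t in Ioo 0 T, ψ t • F t with hc
  refine ⟨c, ?_⟩
  have key : ∀ᵐ t : ℝ, t ∈ Ioo 0 T → F t - c = 0 := by
    apply isOpen_Ioo.ae_eq_zero_of_integral_contDiff_smul_eq_zero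
      ((hFi.sub (integrableOn_const (by simp))).locallyIntegrableOn)
    intro η hη hηc hηs
    -- Since `η - m ψ` has integral zero, it is the derivative of a test function, and `F`
    -- integrates to zero against it. Hence `∫ η F = m ∫ ψ F = ∫ η c`.
    set m : ℝ := ∫ t, η t with hm
    have hηi : Integrable η := hη.continuous.integrable_of_hasCompactSupport hηc
    have hψi : Integrable ψ := hψ.continuous.integrable_of_hasCompactSupport hψc
    have hψc' : HasCompactSupport fun t => m * ψ t := hψc.mul_left
    obtain ⟨φ, hφ, hφc, hφs, hφd⟩ := exists_test_primitive hT
      (θ := fun t => η t - m * ψ t) (hη.sub (contDiff_const.mul hψ)) (hηc.sub hψc')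
      ((tsupport_sub _ _).trans (union_subset hηs ((tsupport_mul_subset_right).trans hψs)))
      (by rw [integral_sub hηi (hψi.const_mul m), integral_const_mul, hψ1]; simp [hm])
    have e := hF0 φ hφ hφc hφs
    rw [hφd] at e
    simp only [sub_smul, mul_smul] at e
    have hψF : IntegrableOn (fun t => m • ψ t • F t) (Ioo 0 T) :=
      (hmul hψ.continuous hψc hFi).smul m
    rw [integral_sub (hmul hη.continuous hηc hFi) hψF, integral_smul, sub_eq_zero] at e
    change ∫ t, η t • (F t - c) = 0
    have hz : ∀ t, t ∉ Ioo 0 T → η t • (F t - c) = 0 := fun t ht => by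
      rw [eq_zero_of_tsupport_subset hηs ht, zero_smul]
    rw [← setIntegral_eq_integral_of_forall_compl_eq_zero hz]
    simp only [smul_sub]
    rw [integral_sub (hmul hη.continuous hηc hFi)
      (hmul hη.continuous hηc (integrableOn_const (by simp))), e, integral_smul_const,
      setIntegral_eq_integral_of_forall_compl_eq_zero
        (fun t ht => eq_zero_of_tsupport_subset hηs ht), sub_self]
  rw [ae_restrict_iff' measurableSet_Ioo]
  filter_upwards [key] with t ht hmem
  have := ht hmem
  simp only [hF, sub_eq_zero] at this
  rw [← this]
  abel

end WeakDerivative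

/-! ### Smoothing by moving averages that stay inside the interval -/

section Averaging

open Filter Topology

variable {E F : Type*} [NormedAddCommGroup E] [NormedSpace ℝ E]
  [NormedAddCommGroup F] [NormedSpace ℝ F]

/-- The average of `v` over the interval `[(1-h)t, (1-h)t + hT]`, a subinterval of `[0,T]` of
length `hT` which moves from the left to the right end as `t` runs through `[0,T]`. -/
noncomputable def movingAverage (T h : ℝ) (v : ℝ → E) (t : ℝ) : E :=
  ∫ σ in (0 : ℝ)..1, v ((1 - h) * t + h * T * σ)

lemma movingAverage_eq {T h : ℝ} (hT : 0 < T) (hh : 0 < h) (v : ℝ → E) (t : ℝ) :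
    movingAverage T h v t =
      (h * T)⁻¹ • ∫ s in (1 - h) * t..(1 - h) * t + h * T, v s := by
  rw [movingAverage, intervalIntegral.integral_comp_add_mul _ (mul_pos hh hT).ne']
  simp

lemma intervalIntegrable_comp_affine {G : Type*} [NormedAddCommGroup G] {v : ℝ → G}
    (hv : LocallyIntegrable v) {c : ℝ} (hc : c ≠ 0)
    (d a b : ℝ) : IntervalIntegrable (fun σ => v (d + c * σ)) volume a b := by
  have h1 : IntervalIntegrable v volume (d + c * a) (d + c * b) :=
      (hv.integrableOn_isCompact isCompact_uIcc).intervalIntegrable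
  have h2 := (h1.comp_add_left d).comp_mul_left (c := c)
  simp only [add_sub_cancel_left] at h2
  rwa [mul_div_cancel_left₀ _ hc, mul_div_cancel_left₀ _ hc] at h2

lemma movingAverage_sub {T h : ℝ} (hT : 0 < T) (hh : 0 < h) {v w : ℝ → E}
    (hv : LocallyIntegrable v) (hw : LocallyIntegrable w) (t : ℝ) :
    movingAverage T h (v - w) t = movingAverage T h v t - movingAverage T h w t :=
  intervalIntegral.integral_sub (intervalIntegrable_comp_affine hv (mul_pos hh hT).ne' _ _ _)
    (intervalIntegrable_comp_affine hw (mul_pos hh hT).ne' _ _ _)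

lemma movingAverage_clm [CompleteSpace E] [CompleteSpace F] {T h : ℝ} (hT : 0 < T) (hh : 0 < h)
    (L : E →L[ℝ] F) {v : ℝ → E} (hv : LocallyIntegrable v) (t : ℝ) :
    movingAverage T h (fun s => L (v s)) t = L (movingAverage T h v t) :=
  L.intervalIntegral_comp_comm (intervalIntegrable_comp_affine hv (mul_pos hh hT).ne' _ _ _)

lemma movingAverage_point_mem {T h t σ : ℝ} (hh : 0 < h) (hh1 : h < 1)
    (hT : 0 < T) (ht : t ∈ Ioo 0 T) (hσ : σ ∈ Ioc (0 : ℝ) 1) :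
    (1 - h) * t + h * T * σ ∈ Ioo 0 T := by
  have h1 : 0 < (1 - h) * t := mul_pos (by linarith) ht.1
  have h2 : 0 < h * T * σ := mul_pos (mul_pos hh hT) hσ.1
  have h3 : (1 - h) * t < (1 - h) * T := mul_lt_mul_of_pos_left ht.2 (by linarith)
  have h4 : h * T * σ ≤ h * T * 1 := mul_le_mul_of_nonneg_left hσ.2 (mul_pos hh hT).le
  constructor <;> linarith

lemma ae_comp_affine {T h t : ℝ} (hT : 0 < T) (hh : 0 < h) {p : ℝ → Prop} (hp : ∀ᵐ s, p s) :
    ∀ᵐ σ : ℝ, p ((1 - h) * t + h * T * σ) := by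
  have h1 : Measure.QuasiMeasurePreserving (fun σ : ℝ => (1 - h) * t + h * T * σ) volume volume := by
    refine (measurePreserving_add_left volume ((1 - h) * t)).quasiMeasurePreserving.comp
      ⟨by fun_prop, ?_⟩
    rw [Real.map_volume_mul_left (mul_pos hh hT).ne']
    exact Measure.smul_absolutelyContinuous
  exact h1.ae hp

/-- The average at an interior time only sees the values on `(0,T)`. -/
lemma movingAverage_congr {T h : ℝ} (hT : 0 < T) (hh : 0 < h) (hh1 : h < 1) {v w : ℝ → E}
    (hvw : ∀ᵐ t ∂(volume.restrict (Ioo 0 T)), v t = w t) {t : ℝ} (ht : t ∈ Ioo 0 T) :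
    movingAverage T h v t = movingAverage T h w t := by
  rw [ae_restrict_iff' measurableSet_Ioo] at hvw
  apply intervalIntegral.integral_congr_ae
  filter_upwards [ae_comp_affine (t := t) hT hh hvw] with σ hσ hσ'
  rw [uIoc_of_le zero_le_one] at hσ'
  exact hσ (movingAverage_point_mem hh hh1 hT ht hσ')

lemma continuous_movingAverage {T h : ℝ} (hT : 0 < T) (hh : 0 < h) {v : ℝ → E}
    (hv : LocallyIntegrable v) : Continuous (movingAverage T h v) := by
  have hi : ∀ a b, IntervalIntegrable v volume a b := fun a b =>
      (hv.integrableOn_isCompact isCompact_uIcc).intervalIntegrable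
  have hc : Continuous fun b => ∫ s in (0 : ℝ)..b, v s :=
    intervalIntegral.continuous_primitive hi 0
  have : movingAverage T h v = fun t => (h * T)⁻¹ •
      ((∫ s in (0 : ℝ)..(1 - h) * t + h * T, v s) - ∫ s in (0 : ℝ)..(1 - h) * t, v s) := by
    funext t
    rw [movingAverage_eq hT hh, intervalIntegral.integral_interval_sub_left (hi _ _) (hi _ _)]
  rw [this]
  exact ((hc.comp (by fun_prop)).sub (hc.comp (by fun_prop))).const_smul _

/-- Both ends of the window move with speed `1 - h`, so the derivative is a difference of two values
of the primitive, which is again an integral of `g` over the window. Averaging thus commutes with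
differentiation up to the factor `1 - h`. -/
lemma hasDerivAt_movingAverage [CompleteSpace E] {T h : ℝ} (hT : 0 < T) (hh : 0 < h) {c : E}
    {g : ℝ → E} (hg : LocallyIntegrable g) (t : ℝ) :
    HasDerivAt (movingAverage T h fun t => c + ∫ s in (0 : ℝ)..t, g s)
      ((1 - h) • movingAverage T h g t) t := by
  have hi : ∀ a b, IntervalIntegrable g volume a b := fun a b =>
      (hg.integrableOn_isCompact isCompact_uIcc).intervalIntegrable
  set Y : ℝ → E := fun t => c + ∫ s in (0 : ℝ)..t, g s with hY
  have hYc : Continuous Y := continuous_const.add (intervalIntegral.continuous_primitive hi 0)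
  have hP : ∀ t, HasDerivAt (fun b => ∫ s in (0 : ℝ)..b, Y s) (Y t) t := fun t =>
    intervalIntegral.integral_hasDerivAt_right (hYc.intervalIntegrable _ _)
      (hYc.stronglyMeasurableAtFilter _ _) hYc.continuousAt
  have h1 : HasDerivAt (fun t : ℝ => (1 - h) * t) (1 - h) t := by
    simpa using (hasDerivAt_id t).const_mul (1 - h)
  have h2 : HasDerivAt (fun t : ℝ => (1 - h) * t + h * T) (1 - h) t := h1.add_const _
  have e : movingAverage T h Y = fun t => (h * T)⁻¹ •
      ((∫ s in (0 : ℝ)..(1 - h) * t + h * T, Y s) - ∫ s in (0 : ℝ)..(1 - h) * t, Y s) := by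
    funext t
    rw [movingAverage_eq hT hh, intervalIntegral.integral_interval_sub_left
      (hYc.intervalIntegrable _ _) (hYc.intervalIntegrable _ _)]
  rw [e]
  have h3 := (((hP _).scomp t h2).sub ((hP _).scomp t h1)).const_smul (h * T)⁻¹
  refine h3.congr_deriv ?_
  rw [movingAverage_eq hT hh, ← smul_sub, smul_comm]
  congr 2
  simp only [hY, add_sub_add_left_eq_sub]
  rw [intervalIntegral.integral_interval_sub_left (hi _ _) (hi _ _)]

lemma sq_lintegral_enorm_le {G : Type*} [NormedAddCommGroup G] {μ : Measure ℝ}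
    [IsProbabilityMeasure μ] {f : ℝ → G}
    (hf : AEStronglyMeasurable f μ) :
    (∫⁻ x, ‖f x‖ₑ ∂μ) ^ (2 : ℝ) ≤ ∫⁻ x, ‖f x‖ₑ ^ (2 : ℝ) ∂μ := by
  have h1 : eLpNorm f 1 μ ≤ eLpNorm f 2 μ :=
    eLpNorm_le_eLpNorm_of_exponent_le (by norm_num) hf
  have h2 := eLpNorm_nnreal_pow_eq_lintegral (μ := μ) (f := f) (p := 2) two_ne_zero
  rw [eLpNorm_one_eq_lintegral_enorm] at h1
  simp only [NNReal.coe_ofNat, ENNReal.coe_ofNat] at h2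
  rw [← h2]
  gcongr

lemma lintegral_comp_affine_le {T a b : ℝ} (ha : 0 < a) {F : ℝ → ℝ≥0∞} (hF : Measurable F)
    (hmem : ∀ t ∈ Ioo 0 T, a * t + b ∈ Ioo 0 T) :
    ∫⁻ t in Ioo 0 T, F (a * t + b) ≤ ENNReal.ofReal a⁻¹ * ∫⁻ t in Ioo 0 T, F t := by
  set G := (Ioo 0 T).indicator F with hG
  have hGm : Measurable G := hF.indicator measurableSet_Ioo
  calc ∫⁻ t in Ioo 0 T, F (a * t + b)
      = ∫⁻ t in Ioo 0 T, G (a * t + b) := by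
        apply setLIntegral_congr_fun measurableSet_Ioo
        intro t ht
        simp [hG, hmem t ht]
    _ ≤ ∫⁻ t, G (a * t + b) := setLIntegral_le_lintegral _ _
    _ = ∫⁻ s, G (s + b) ∂(Measure.map (fun t => a * t) volume) := by
        rw [lintegral_map (f := fun s => G (s + b)) (hGm.comp (measurable_add_const b))
          (measurable_const_mul a)]
    _ = ENNReal.ofReal a⁻¹ * ∫⁻ t, G t := by
        rw [Real.map_volume_mul_left ha.ne', lintegral_smul_measure, lintegral_add_right_eq_self,
          abs_of_pos (inv_pos.2 ha), smul_eq_mul]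
    _ = ENNReal.ofReal a⁻¹ * ∫⁻ t in Ioo 0 T, F t := by
        rw [hG, lintegral_indicator measurableSet_Ioo]

/-- Jensen's inequality for the average over `σ`, then Tonelli, then the substitution `s = (1 - h) t
+ h T σ`, which costs the factor `(1 - h)⁻¹ ≤ 2` in the squared norms. What matters is that the
bound is uniform in `h`. -/
lemma eLpNorm_movingAverage_le {T h : ℝ} (hT : 0 < T) (hh : 0 < h) (hh1 : h ≤ 1 / 2)
    {v : ℝ → E} (hv : AEStronglyMeasurable v (volume.restrict (Ioo 0 T))) :
    eLpNorm (movingAverage T h v) 2 (volume.restrict (Ioo 0 T)) ≤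
      2 * eLpNorm v 2 (volume.restrict (Ioo 0 T)) := by
  set μ := volume.restrict (Ioo 0 T) with hμ
  have hh1' : h < 1 := by linarith
  set w := hv.mk v with hw
  have hwm : StronglyMeasurable w := hv.stronglyMeasurable_mk
  have hvw : v =ᵐ[μ] w := hv.ae_eq_mk
  have hAvw : movingAverage T h v =ᵐ[μ] movingAverage T h w := by
    filter_upwards [ae_restrict_mem measurableSet_Ioo] with t ht
    exact movingAverage_congr hT hh hh1' hvw ht
  rw [eLpNorm_congr_ae hAvw, eLpNorm_congr_ae hvw]
  have key : ∫⁻ t, ‖movingAverage T h w t‖ₑ ^ (2 : ℝ) ∂μ ≤ 2 * ∫⁻ t, ‖w t‖ₑ ^ (2 : ℝ) ∂μ := by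
    have hwF : Measurable fun t => ‖w t‖ₑ ^ (2 : ℝ) := (hwm.enorm).pow_const _
    have hprob : IsProbabilityMeasure (volume.restrict (Ioc (0 : ℝ) 1)) := ⟨by simp⟩
    calc ∫⁻ t, ‖movingAverage T h w t‖ₑ ^ (2 : ℝ) ∂μ
        ≤ ∫⁻ t, ∫⁻ σ in Ioc (0 : ℝ) 1, ‖w ((1 - h) * t + h * T * σ)‖ₑ ^ (2 : ℝ) ∂volume ∂μ := by
          apply lintegral_mono
          intro t
          refine le_trans ?_ (sq_lintegral_enorm_le
            (hwm.comp_measurable (by fun_prop)).aestronglyMeasurable)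
          simp only [movingAverage, intervalIntegral.integral_of_le zero_le_one]
          gcongr
          exact enorm_integral_le_lintegral_enorm _
      _ = ∫⁻ σ in Ioc (0 : ℝ) 1, ∫⁻ t, ‖w ((1 - h) * t + h * T * σ)‖ₑ ^ (2 : ℝ) ∂μ := by
          apply lintegral_lintegral_swap
          exact (hwF.comp (by fun_prop :
            Measurable fun p : ℝ × ℝ => (1 - h) * p.1 + h * T * p.2)).aemeasurable
      _ ≤ ∫⁻ σ in Ioc (0 : ℝ) 1, 2 * ∫⁻ t, ‖w t‖ₑ ^ (2 : ℝ) ∂μ := by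
          apply setLIntegral_mono measurable_const
          intro σ hσ
          refine (lintegral_comp_affine_le (by linarith) hwF
            fun t ht => movingAverage_point_mem hh hh1' hT ht hσ).trans ?_
          gcongr
          rw [← ENNReal.ofReal_ofNat]
          apply ENNReal.ofReal_le_ofReal
          rw [inv_le_comm₀ (by linarith) (by norm_num)]
          linarith
      _ = 2 * ∫⁻ t, ‖w t‖ₑ ^ (2 : ℝ) ∂μ := by simp
  have h2 : ∀ f : ℝ → E, eLpNorm f 2 μ ^ (2 : ℝ) = ∫⁻ x, ‖f x‖ₑ ^ (2 : ℝ) ∂μ := fun f => by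
    have := eLpNorm_nnreal_pow_eq_lintegral (μ := μ) (f := f) (p := 2) two_ne_zero
    simpa only [NNReal.coe_ofNat, ENNReal.coe_ofNat] using this
  rw [← h2, ← h2] at key
  rw [← ENNReal.rpow_le_rpow_iff (z := 2) (by norm_num), ENNReal.mul_rpow_of_nonneg _ _ (by norm_num)]
  refine key.trans ?_
  gcongr
  norm_num

lemma exists_movingAverage_sub_le [CompleteSpace E] {T : ℝ} (hT : 0 < T) {f : ℝ → E} (hf : Continuous f)
    {η : ℝ} (hη : 0 < η) : ∃ δ > 0, ∀ h, 0 < h → h < 1 → h < δ → ∀ t ∈ Ioo 0 T,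
      ‖movingAverage T h f t - f t‖ ≤ η := by
  obtain ⟨δ, hδ, H⟩ := Metric.uniformContinuousOn_iff.1
    (isCompact_Icc.uniformContinuousOn_of_continuous (hf.continuousOn (s := Icc 0 T))) η hη
  refine ⟨δ / T, div_pos hδ hT, fun h hh hh1 hhδ t ht => ?_⟩
  rw [lt_div_iff₀ hT] at hhδ
  have e : movingAverage T h f t - f t =
      ∫ σ in (0 : ℝ)..1, (f ((1 - h) * t + h * T * σ) - f t) := by
    rw [intervalIntegral.integral_sub
      ((by fun_prop : Continuous fun σ => f ((1 - h) * t + h * T * σ)).intervalIntegrable _ _)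
      (by simp)]
    simp [movingAverage]
  rw [e]
  refine (intervalIntegral.norm_integral_le_of_norm_le_const (C := η) ?_).trans (by simp)
  intro σ hσ
  rw [uIoc_of_le zero_le_one] at hσ
  rw [← dist_eq_norm]
  refine (H _ (Ioo_subset_Icc_self (movingAverage_point_mem hh hh1 hT ht hσ)) _
    (Ioo_subset_Icc_self ht) ?_).le
  rw [Real.dist_eq]
  refine lt_of_le_of_lt ?_ hhδ
  rw [abs_le]
  have h1 : h * t ≤ h * T := mul_le_mul_of_nonneg_left ht.2.le hh.le
  have h2 : 0 ≤ h * t := mul_nonneg hh.le ht.1.le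
  have h3 : h * T * σ ≤ h * T * 1 := mul_le_mul_of_nonneg_left hσ.2 (mul_pos hh hT).le
  have h4 : 0 ≤ h * T * σ := mul_nonneg (mul_pos hh hT).le hσ.1.le
  constructor <;> linarith

/-- The moving averages converge in `L²(0,T)` as their length tends to zero. -/
lemma tendsto_eLpNorm_movingAverage_sub [CompleteSpace E] {T : ℝ} (hT : 0 < T) {v : ℝ → E}
    (hv : LocallyIntegrable v) (hv2 : MemLp v 2 (volume.restrict (Ioo 0 T)))
    {h : ℕ → ℝ} (hh : ∀ n, 0 < h n) (hh1 : ∀ n, h n ≤ 1 / 2) (hh0 : Tendsto h atTop (𝓝 0)) :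
    Tendsto (fun n => eLpNorm (movingAverage T (h n) v - v) 2 (volume.restrict (Ioo 0 T)))
      atTop (𝓝 0) := by
  set μ := volume.restrict (Ioo 0 T) with hμ
  rw [ENNReal.tendsto_nhds_zero]
  intro ε hε
  -- Three-term argument with a continuous `f` near `v`: averaging `v - f` costs `2 (ε / 4)` by the
  -- uniform bound, while the averaging error of `f` and the difference `f - v` cost `ε / 4` each.
  obtain ⟨f, hfc, hf, hf2⟩ : ∃ f : ℝ → E, Continuous f ∧ eLpNorm (v - f) 2 μ ≤ ε / 4 ∧
      MemLp f 2 μ := by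
    obtain ⟨f, hf, hf2⟩ := hv2.exists_boundedContinuous_eLpNorm_sub_le (by norm_num)
      (ε := ε / 4) (ENNReal.div_pos hε.ne' (by norm_num)).ne'
    exact ⟨f, f.continuous, hf, hf2⟩
  have hfl : LocallyIntegrable f := hfc.locallyIntegrable
  obtain ⟨η, hη, hηε⟩ : ∃ η : ℝ, 0 < η ∧
      μ univ ^ (2 : ℝ≥0∞).toReal⁻¹ * ENNReal.ofReal η ≤ ε / 4 := by
    have hK : μ univ ^ (2 : ℝ≥0∞).toReal⁻¹ ≠ ⊤ := by
      apply ENNReal.rpow_ne_top_of_nonneg (by simp)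
      exact measure_ne_top _ _
    have h1 : Tendsto (fun η : ℝ => μ univ ^ (2 : ℝ≥0∞).toReal⁻¹ * ENNReal.ofReal η) (𝓝[>] 0)
        (𝓝 0) := by
      have : Tendsto (fun η : ℝ => ENNReal.ofReal η) (𝓝[>] 0) (𝓝 0) := by
        have h0 := (ENNReal.continuous_ofReal.tendsto 0).mono_left
          (nhdsWithin_le_nhds (s := Ioi (0 : ℝ)))
        rwa [ENNReal.ofReal_zero] at h0
      simpa using ENNReal.Tendsto.const_mul this (Or.inr hK)
    have h2 := (ENNReal.tendsto_nhds_zero.1 h1 (ε / 4) (ENNReal.div_pos hε.ne' (by norm_num)))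
    obtain ⟨η, h3, h4⟩ := (h2.and self_mem_nhdsWithin).exists
    exact ⟨η, h4, h3⟩
  obtain ⟨δ, hδ, H⟩ := exists_movingAverage_sub_le hT hfc hη
  filter_upwards [hh0.eventually (gt_mem_nhds hδ)] with n hn
  have hn1 : h n < 1 := (hh1 n).trans_lt (by norm_num)
  have e : movingAverage T (h n) v - v =
      movingAverage T (h n) (v - f) + (movingAverage T (h n) f - f) + (f - v) := by
    funext t
    simp only [Pi.add_apply, Pi.sub_apply, movingAverage_sub hT (hh n) hv hfl]
    abel
  have m1 : AEStronglyMeasurable (movingAverage T (h n) (v - f)) μ :=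
    (continuous_movingAverage hT (hh n) (hv.sub hfl)).aestronglyMeasurable
  have m2 : AEStronglyMeasurable (movingAverage T (h n) f - f) μ :=
    ((continuous_movingAverage hT (hh n) hfl).sub hfc).aestronglyMeasurable
  have m3 : AEStronglyMeasurable (f - v) μ := hf2.1.sub hv2.1
  have b1 : eLpNorm (movingAverage T (h n) (v - f)) 2 μ ≤ 2 * (ε / 4) :=
    (eLpNorm_movingAverage_le hT (hh n) (hh1 n) (hv2.1.sub hf2.1)).trans (by gcongr)
  have b2 : eLpNorm (movingAverage T (h n) f - f) 2 μ ≤ ε / 4 := by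
    refine (eLpNorm_le_of_ae_bound (C := η) ?_).trans hηε
    filter_upwards [ae_restrict_mem measurableSet_Ioo] with t ht
    exact H (h n) (hh n) hn1 hn t ht
  have b3 : eLpNorm (f - v) 2 μ ≤ ε / 4 := by rwa [eLpNorm_sub_comm]
  rw [e]
  calc _ ≤ eLpNorm (movingAverage T (h n) (v - f)) 2 μ + eLpNorm (movingAverage T (h n) f - f) 2 μ
        + eLpNorm (f - v) 2 μ :=
        (eLpNorm_add_le (m1.add m2) m3 (by norm_num)).trans (by
          gcongr; exact eLpNorm_add_le m1 m2 (by norm_num))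
    _ ≤ 2 * (ε / 4) + ε / 4 + ε / 4 := by gcongr
    _ = 4 * (ε / 4) := by ring
    _ = ε := ENNReal.mul_div_cancel (by norm_num) (by norm_num)

end Averaging

/-! ### The energy identity and the embedding of `W(0,T)` into `C([0,T]; H)` -/

section Energy

open Filter Topology

variable {V H : Type*} [NormedAddCommGroup V] [InnerProductSpace ℝ V]
  [NormedAddCommGroup H] [InnerProductSpace ℝ H]

lemma sq_norm_toLp {E : Type*} [NormedAddCommGroup E] {μ : Measure ℝ} {f : ℝ → E}
    (hf : MemLp f 2 μ) : ‖hf.toLp f‖ ^ 2 = ∫ t, ‖f t‖ ^ 2 ∂μ := by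
  have h0 : 0 ≤ ∫ t, ‖f t‖ ^ 2 ∂μ := integral_nonneg fun t => by positivity
  rw [Lp.norm_toLp, hf.eLpNorm_eq_integral_rpow_norm (by norm_num) (by norm_num)]
  simp only [ENNReal.toReal_ofNat, Real.rpow_ofNat]
  rw [ENNReal.toReal_ofReal (by positivity), ← Real.rpow_natCast, ← Real.rpow_mul h0]
  norm_num

lemma integrable_sq_norm {E : Type*} [NormedAddCommGroup E] {μ : Measure ℝ} {f : ℝ → E}
    (hf : MemLp f 2 μ) : Integrable (fun t => ‖f t‖ ^ 2) μ :=
  hf.integrable_norm_pow (p := 2) two_ne_zero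

lemma integrable_dual_apply {μ : Measure ℝ} {g : ℝ → StrongDual ℝ V} {v : ℝ → V}
    (hg : MemLp g 2 μ) (hv : MemLp v 2 μ) : Integrable (fun t => g t (v t)) μ := by
  rw [← memLp_one_iff_integrable]
  exact (ContinuousLinearMap.id ℝ (StrongDual ℝ V)).memLp_of_bilin (r := 1) hg hv

/-- The duality pairing is continuous on `L²(V*) × L²(V)`. -/
lemma tendsto_integral_dual_apply {μ : Measure ℝ} {gn : ℕ → ℝ → StrongDual ℝ V}
    {vn : ℕ → ℝ → V} {g : ℝ → StrongDual ℝ V} {v : ℝ → V} (hgn : ∀ n, MemLp (gn n) 2 μ)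
    (hvn : ∀ n, MemLp (vn n) 2 μ) (hg : MemLp g 2 μ) (hv : MemLp v 2 μ)
    (h1 : Tendsto (fun n => eLpNorm (gn n - g) 2 μ) atTop (𝓝 0))
    (h2 : Tendsto (fun n => eLpNorm (vn n - v) 2 μ) atTop (𝓝 0)) :
    Tendsto (fun n => ∫ t, gn n t (vn n t) ∂μ) atTop (𝓝 (∫ t, g t (v t) ∂μ)) := by
  set B := (ContinuousLinearMap.id ℝ (StrongDual ℝ V)).lpPairing μ 2 2 with hB
  have key : ∀ {a : ℝ → StrongDual ℝ V} {b : ℝ → V} (ha : MemLp a 2 μ) (hb : MemLp b 2 μ),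
      B (ha.toLp a) (hb.toLp b) = ∫ t, a t (b t) ∂μ := by
    intro a b ha hb
    rw [hB, ContinuousLinearMap.lpPairing_eq_integral]
    apply integral_congr_ae
    filter_upwards [ha.coeFn_toLp, hb.coeFn_toLp] with t h1 h2
    rw [h1, h2]
    rfl
  have t1 := (Lp.tendsto_Lp_iff_tendsto_eLpNorm'' gn hgn g hg).2 h1
  have t2 := (Lp.tendsto_Lp_iff_tendsto_eLpNorm'' vn hvn v hv).2 h2
  have t3 := (B.continuous₂.tendsto (hg.toLp g, hv.toLp v)).comp (t1.prodMk_nhds t2)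
  simpa only [Function.comp_def, Function.uncurry_apply_pair, key] using t3

/-- The embedding `V ↪ V*` of a Gelfand triple as a continuous linear map. -/
noncomputable def pivotEmbedding (ι : V →L[ℝ] H) : V →L[ℝ] StrongDual ℝ V :=
  (((ContinuousLinearMap.compL ℝ V H ℝ).flip ι).comp (innerSL ℝ)).comp ι

@[simp] lemma pivotEmbedding_apply (ι : V →L[ℝ] H) (v : V) :
    pivotEmbedding ι v = toDual ι (ι v) := rfl

@[simp] lemma toDual_apply (ι : V →L[ℝ] H) (h : H) (v : V) :
    toDual ι h v = inner ℝ h (ι v) := rfl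

lemma continuous_toDual (ι : V →L[ℝ] H) : Continuous (toDual ι) :=
  (((ContinuousLinearMap.compL ℝ V H ℝ).flip ι).comp (innerSL ℝ)).continuous

lemma toDual_injective {ι : V →L[ℝ] H} (hι : DenseRange ι) : Function.Injective (toDual ι) := by
  intro h k hhk
  rw [← sub_eq_zero]
  apply hι.eq_zero_of_inner_left ℝ
  intro v
  have := congrArg (fun f => f v) hhk
  simp only [toDual_apply] at this
  rw [inner_sub_left, this, sub_self]

/-- The energy `‖ι w‖²` is differentiable as soon as `w` is continuous in `V` and differentiable
in `V*`. -/
lemma hasDerivAt_sq_norm_of_dual {ι : V →L[ℝ] H} {w : ℝ → V} {t : ℝ} {γ : StrongDual ℝ V}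
    (hw : ContinuousAt w t) (hd : HasDerivAt (fun s => pivotEmbedding ι (w s)) γ t) :
    HasDerivAt (fun s => ‖ι (w s)‖ ^ 2) (2 * γ (w t)) t := by
  rw [hasDerivAt_iff_tendsto_slope] at hd ⊢
  -- By `‖x‖² - ‖y‖² = (x - y, x + y)`, the slope of the energy is the slope of `pivotEmbedding ι ∘
  -- w` applied to `w s + w t`. The former converges in `V*`, the latter in `V`.
  have h1 : Tendsto (fun s => w s + w t) (𝓝[≠] t) (𝓝 (w t + w t)) :=
    (hw.tendsto.mono_left nhdsWithin_le_nhds).add tendsto_const_nhds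
  have h2 := (isBoundedBilinearMap_apply.continuous.tendsto (γ, w t + w t)).comp
    (hd.prodMk_nhds h1)
  have e : γ (w t + w t) = 2 * γ (w t) := by rw [map_add]; ring
  simp only [e] at h2
  refine h2.congr fun s => ?_
  simp only [Function.comp_apply, slope_def_module, smul_apply, sub_apply,
    map_add, pivotEmbedding_apply, toDual_apply, smul_eq_mul, real_inner_self_eq_norm_sq]
  rw [real_inner_comm (ι (w t)) (ι (w s))]
  ring

lemma energy_identity_of_continuous {ι : V →L[ℝ] H} {T : ℝ} {w : ℝ → V}
    {G : ℝ → StrongDual ℝ V} (hw : Continuous w) (hG : Continuous G)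
    (hd : ∀ t ∈ Ioo 0 T, HasDerivAt (fun s => pivotEmbedding ι (w s)) (G t) t)
    {s t : ℝ} (hs : s ∈ Icc 0 T) (ht : t ∈ Icc 0 T) (hst : s ≤ t) :
    ‖ι (w t)‖ ^ 2 - ‖ι (w s)‖ ^ 2 = 2 * ∫ r in s..t, G r (w r) := by
  have hc : Continuous fun r => G r (w r) := hG.clm_apply hw
  rw [← intervalIntegral.integral_const_mul]
  symm
  apply intervalIntegral.integral_eq_sub_of_hasDerivAt_of_le hst
  · exact ((ι.continuous.comp hw).norm.pow 2).continuousOn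
  · intro r hr
    exact hasDerivAt_sq_norm_of_dual hw.continuousAt
      (hd r ⟨hs.1.trans_lt hr.1, hr.2.trans_le ht.2⟩)
  · exact (continuous_const.mul hc).intervalIntegrable _ _

lemma memLp_of_continuous {E : Type*} [NormedAddCommGroup E] {T : ℝ} {f : ℝ → E}
    (hf : Continuous f) : MemLp f 2 (volume.restrict (Ioo 0 T)) := by
  obtain ⟨C, hC⟩ := isCompact_Icc.exists_bound_of_continuousOn (hf.continuousOn (s := Icc 0 T))
  refine MemLp.of_bound hf.aestronglyMeasurable C ?_
  filter_upwards [ae_restrict_mem measurableSet_Ioo] with t ht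
  exact hC t (Ioo_subset_Icc_self ht)

/-- The energy identity between `s` and `t`, with Young's inequality for the pairing, bounds `‖ι (w
t)‖²` by `‖ι (w s)‖²` plus `L²` norms. Averaging over `s ∈ (0,T)` removes the point value, which
explains the factor `‖ι‖² / T`. -/
lemma sq_norm_le_of_continuous {ι : V →L[ℝ] H} {T : ℝ} (hT : 0 < T) {w : ℝ → V}
    {G : ℝ → StrongDual ℝ V} (hw : Continuous w) (hG : Continuous G)
    (hd : ∀ t ∈ Ioo 0 T, HasDerivAt (fun s => pivotEmbedding ι (w s)) (G t) t)
    {t : ℝ} (ht : t ∈ Icc 0 T) :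
    ‖ι (w t)‖ ^ 2 ≤ (‖ι‖ ^ 2 / T + 1) * (∫ r in Ioo 0 T, ‖w r‖ ^ 2) +
      ∫ r in Ioo 0 T, ‖G r‖ ^ 2 := by
  set R : ℝ := (∫ r in Ioo 0 T, ‖w r‖ ^ 2) + ∫ r in Ioo 0 T, ‖G r‖ ^ 2 with hR
  have iw := integrable_sq_norm (memLp_of_continuous (T := T) hw)
  have iG := integrable_sq_norm (memLp_of_continuous (T := T) hG)
  have hc : Continuous fun r => G r (w r) := hG.clm_apply hw
  have hpt : ∀ r, |2 * G r (w r)| ≤ ‖w r‖ ^ 2 + ‖G r‖ ^ 2 := by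
    intro r
    have h1 : |G r (w r)| ≤ ‖G r‖ * ‖w r‖ := (G r).le_opNorm (w r)
    rw [abs_mul, abs_two]
    nlinarith [sq_nonneg (‖G r‖ - ‖w r‖)]
  have hbd : ∀ a b, a ∈ Icc 0 T → b ∈ Icc 0 T → a ≤ b →
      |2 * ∫ r in a..b, G r (w r)| ≤ R := by
    intro a b ha hb hab
    rw [← intervalIntegral.integral_const_mul, intervalIntegral.integral_of_le hab,
      integral_Ioc_eq_integral_Ioo, hR, ← integral_add iw iG]
    have hsub : Ioo a b ⊆ Ioo 0 T := fun x hx => ⟨ha.1.trans_lt hx.1, hx.2.trans_le hb.2⟩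
    calc |∫ r in Ioo a b, 2 * G r (w r)| ≤ ∫ r in Ioo a b, |2 * G r (w r)| :=
          abs_integral_le_integral_abs
      _ ≤ ∫ r in Ioo a b, (‖w r‖ ^ 2 + ‖G r‖ ^ 2) := by
          apply integral_mono_of_nonneg (ae_of_all _ fun r => abs_nonneg _)
            ((iw.add iG).mono_measure (Measure.restrict_mono hsub le_rfl)) (ae_of_all _ hpt)
      _ ≤ ∫ r in Ioo 0 T, (‖w r‖ ^ 2 + ‖G r‖ ^ 2) :=
          setIntegral_mono_set (iw.add iG) (ae_of_all _ fun r => by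
            simp only [Pi.zero_apply]; positivity)
            hsub.eventuallyLE
  have hpoint : ∀ s ∈ Ioo 0 T, ‖ι (w t)‖ ^ 2 ≤ ‖ι‖ ^ 2 * ‖w s‖ ^ 2 + R := by
    intro s hs
    have hs' := Ioo_subset_Icc_self hs
    have h1 : ‖ι (w s)‖ ^ 2 ≤ ‖ι‖ ^ 2 * ‖w s‖ ^ 2 := by
      rw [← mul_pow]
      gcongr
      exact ι.le_opNorm _
    rcases le_total s t with hst | hst
    · have h2 := energy_identity_of_continuous hw hG hd hs' ht hst
      have h3 := abs_le.1 (hbd s t hs' ht hst)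
      linarith [h3.2]
    · have h2 := energy_identity_of_continuous hw hG hd ht hs' hst
      have h3 := abs_le.1 (hbd t s ht hs' hst)
      linarith [h3.1]
  have hint := setIntegral_mono_on (μ := volume) (integrableOn_const (by simp))
    ((iw.const_mul (‖ι‖ ^ 2)).add (integrable_const R)) measurableSet_Ioo hpoint
  simp only [Pi.add_apply] at hint
  rw [integral_add (iw.const_mul _) (integrable_const R), integral_const_mul, setIntegral_const,
    setIntegral_const] at hint
  simp only [Measure.real, Real.volume_Ioo, sub_zero, ENNReal.toReal_ofReal hT.le,
    smul_eq_mul] at hint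
  have e : T * ((‖ι‖ ^ 2 / T + 1) * (∫ r in Ioo 0 T, ‖w r‖ ^ 2) + ∫ r in Ioo 0 T, ‖G r‖ ^ 2) =
      ‖ι‖ ^ 2 * (∫ r in Ioo 0 T, ‖w r‖ ^ 2) + T * R := by
    rw [hR]; field_simp; ring
  rw [← e] at hint
  exact le_of_mul_le_mul_left hint hT

variable [CompleteSpace V] [CompleteSpace H]

/-- Moving averages of `v` are continuous in `V` and differentiable in `V*`, and they converge in
`L²` together with their derivatives. The preceding estimate, applied to differences, makes them
uniformly Cauchy in `H`; the limit is the representative, and the energy identity passes to the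
limit. -/
lemma exists_continuous_representative_of_locallyIntegrable (ι : V →L[ℝ] H) {T : ℝ} (hT : 0 < T)
    {v : ℝ → V} {g : ℝ → StrongDual ℝ V} {c : StrongDual ℝ V}
    (hvl : LocallyIntegrable v) (hgl : LocallyIntegrable g)
    (hv : MemLp v 2 (volume.restrict (Ioo 0 T))) (hg : MemLp g 2 (volume.restrict (Ioo 0 T)))
    (h : ∀ᵐ t ∂(volume.restrict (Ioo 0 T)), toDual ι (ι (v t)) = c + ∫ s in 0..t, g s) :
    ∃ y : ℝ → H, ContinuousOn y (Icc 0 T) ∧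
      (∀ᵐ t ∂(volume.restrict (Ioo 0 T)), y t = ι (v t)) ∧
      ∀ t ∈ Icc 0 T, ‖y t‖ ^ 2 - ‖y 0‖ ^ 2 = 2 * ∫ s in 0..t, g s (v s) := by
  set μ := volume.restrict (Ioo 0 T) with hμ
  -- The shift by 2 keeps all window lengths at most `1 / 2`, as the uniform `L²` bound requires.
  set k : ℕ → ℝ := fun n => 1 / ((n : ℝ) + 2) with hk
  have hk0 : ∀ n, 0 < k n := fun n => by positivity
  have hk1 : ∀ n, k n ≤ 1 / 2 := fun n => by
    apply one_div_le_one_div_of_le (by norm_num)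
    have : (0 : ℝ) ≤ n := n.cast_nonneg
    linarith
  have hkt : Tendsto k atTop (𝓝 0) := by
    have : Tendsto (fun n : ℕ => (n : ℝ) + 2) atTop atTop :=
      tendsto_atTop_add_const_right _ _ tendsto_natCast_atTop_atTop
    simpa [hk, Function.comp_def] using tendsto_inv_atTop_zero.comp this
  set w : ℕ → ℝ → V := fun n => movingAverage T (k n) v with hw
  set G : ℕ → ℝ → StrongDual ℝ V := fun n => (1 - k n) • movingAverage T (k n) g with hG
  have hwc : ∀ n, Continuous (w n) := fun n => continuous_movingAverage hT (hk0 n) hvl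
  have hAc : ∀ n, Continuous (movingAverage T (k n) g) := fun n =>
    continuous_movingAverage hT (hk0 n) hgl
  have hGc : ∀ n, Continuous (G n) := fun n => (hAc n).const_smul _
  have hder : ∀ n, ∀ t ∈ Ioo 0 T,
      HasDerivAt (fun s => pivotEmbedding ι (w n s)) (G n t) t := by
    intro n t ht
    refine (hasDerivAt_movingAverage hT (hk0 n) (c := c) hgl t).congr_of_eventuallyEq ?_
    filter_upwards [isOpen_Ioo.mem_nhds ht] with s hs
    rw [hw, ← movingAverage_clm hT (hk0 n) (pivotEmbedding ι) hvl]
    exact movingAverage_congr hT (hk0 n) ((hk1 n).trans_lt (by norm_num)) h hs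
  have hwL : ∀ n, MemLp (w n) 2 μ := fun n => memLp_of_continuous (hwc n)
  have hAL : ∀ n, MemLp (movingAverage T (k n) g) 2 μ := fun n => memLp_of_continuous (hAc n)
  have hGL : ∀ n, MemLp (G n) 2 μ := fun n => memLp_of_continuous (hGc n)
  have tw : Tendsto (fun n => eLpNorm (w n - v) 2 μ) atTop (𝓝 0) :=
    tendsto_eLpNorm_movingAverage_sub hT hvl hv hk0 hk1 hkt
  have tw' := (Lp.tendsto_Lp_iff_tendsto_eLpNorm'' w hwL v hv).2 tw
  have tG' : Tendsto (fun n => (hGL n).toLp (G n)) atTop (𝓝 (hg.toLp g)) := by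
    have t1 := (Lp.tendsto_Lp_iff_tendsto_eLpNorm'' _ hAL g hg).2
      (tendsto_eLpNorm_movingAverage_sub hT hgl hg hk0 hk1 hkt)
    have t2 : Tendsto (fun n => 1 - k n) atTop (𝓝 1) := by simpa using hkt.const_sub 1
    have t3 := t2.smul t1
    rw [one_smul] at t3
    exact t3
  have tG := (Lp.tendsto_Lp_iff_tendsto_eLpNorm'' G hGL g hg).1 tG'
  set C : ℝ := ‖ι‖ ^ 2 / T + 1 with hC
  have hC1 : 0 < C := by positivity
  have hest : ∀ m n, ∀ t ∈ Icc 0 T, ‖ι (w m t) - ι (w n t)‖ ^ 2 ≤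
      C * ‖(hwL m).toLp (w m) - (hwL n).toLp (w n)‖ ^ 2 +
        ‖(hGL m).toLp (G m) - (hGL n).toLp (G n)‖ ^ 2 := by
    intro m n t ht
    have := sq_norm_le_of_continuous (ι := ι) hT (w := w m - w n) (G := G m - G n)
      ((hwc m).sub (hwc n)) ((hGc m).sub (hGc n)) (fun t ht => by
        have := (hder m t ht).sub (hder n t ht)
        refine this.congr_of_eventuallyEq (Eventually.of_forall fun s => ?_)
        simp only [Pi.sub_apply, map_sub]) ht
    rw [← MemLp.toLp_sub, ← MemLp.toLp_sub, sq_norm_toLp, sq_norm_toLp, ← map_sub]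
    exact this
  have hcau : UniformCauchySeqOn (fun n t => ι (w n t)) atTop (Icc 0 T) := by
    rw [Metric.uniformCauchySeqOn_iff]
    intro ε hε
    obtain ⟨N1, hN1⟩ := Metric.cauchySeq_iff.1 tw'.cauchySeq (ε / (2 * (C + 1))) (by positivity)
    obtain ⟨N2, hN2⟩ := Metric.cauchySeq_iff.1 tG'.cauchySeq (ε / 2) (by positivity)
    refine ⟨max N1 N2, fun m hm n hn t ht => ?_⟩
    have h1 := hN1 m (le_of_max_le_left hm) n (le_of_max_le_left hn)
    have h2 := hN2 m (le_of_max_le_right hm) n (le_of_max_le_right hn)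
    rw [dist_eq_norm] at h1 h2 ⊢
    have h3 := hest m n t ht
    refine lt_of_pow_lt_pow_left₀ 2 hε.le (h3.trans_lt ?_)
    have h4 : C * ‖(hwL m).toLp (w m) - (hwL n).toLp (w n)‖ ^ 2 ≤
        C * (ε / (2 * (C + 1))) ^ 2 := by gcongr
    have h5 : ‖(hGL m).toLp (G m) - (hGL n).toLp (G n)‖ ^ 2 ≤ (ε / 2) ^ 2 := by gcongr
    have h6 : C * (ε / (2 * (C + 1))) ^ 2 ≤ ε ^ 2 / 4 := by
      rw [div_pow, mul_div_assoc', div_le_div_iff₀ (by positivity) (by norm_num)]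
      have : 0 ≤ ε ^ 2 * (C ^ 2 + C + 1) := by positivity
      nlinarith
    have h7 : 0 < ε ^ 2 := by positivity
    nlinarith
  have hlim : ∀ t ∈ Icc 0 T, ∃ z, Tendsto (fun n => ι (w n t)) atTop (𝓝 z) := fun t ht =>
    cauchySeq_tendsto_of_complete (hcau.cauchySeq ht)
  choose! y hy using hlim
  have hunif := hcau.tendstoUniformlyOn_of_tendsto hy
  refine ⟨y, hunif.continuousOn (Frequently.of_forall fun n =>
    (ι.continuous.comp (hwc n)).continuousOn), ?_, ?_⟩
  -- A subsequence of the averages converges to `v` almost everywhere in `V`, which identifies the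
  -- uniform limit with `ι ∘ v`.
  · obtain ⟨ns, hns, hae⟩ := (tendstoInMeasure_of_tendsto_eLpNorm (by norm_num)
      (fun n => (hwL n).1) hv.1 tw).exists_seq_tendsto_ae
    filter_upwards [hae, ae_restrict_mem measurableSet_Ioo] with t ht htm
    exact tendsto_nhds_unique ((hy t (Ioo_subset_Icc_self htm)).comp hns.tendsto_atTop)
      ((ι.continuous.tendsto _).comp ht)
  · intro t ht
    have h0 : (0 : ℝ) ∈ Icc 0 T := ⟨le_rfl, hT.le⟩
    have t1 : Tendsto (fun n => ‖ι (w n t)‖ ^ 2 - ‖ι (w n 0)‖ ^ 2) atTop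
        (𝓝 (‖y t‖ ^ 2 - ‖y 0‖ ^ 2)) := ((hy t ht).norm.pow 2).sub ((hy 0 h0).norm.pow 2)
    have hle : volume.restrict (Ioo 0 t) ≤ μ :=
      Measure.restrict_mono (Ioo_subset_Ioo_right ht.2) le_rfl
    have t2 := tendsto_integral_dual_apply (μ := volume.restrict (Ioo 0 t))
      (fun n => (hGL n).mono_measure hle) (fun n => (hwL n).mono_measure hle)
      (hg.mono_measure hle) (hv.mono_measure hle)
      (tendsto_of_tendsto_of_tendsto_of_le_of_le tendsto_const_nhds tG
        (fun n => zero_le) fun n => eLpNorm_mono_measure _ hle)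
      (tendsto_of_tendsto_of_tendsto_of_le_of_le tendsto_const_nhds tw
        (fun n => zero_le) fun n => eLpNorm_mono_measure _ hle)
    refine tendsto_nhds_unique t1 ?_
    rw [intervalIntegral.integral_of_le ht.1, integral_Ioc_eq_integral_Ioo]
    refine (t2.const_mul 2).congr fun n => ?_
    rw [energy_identity_of_continuous (hwc n) (hGc n) (hder n) h0 ht ht.1,
      intervalIntegral.integral_of_le ht.1, integral_Ioc_eq_integral_Ioo]

lemma intervalIntegrable_of_memLp {E : Type*} [NormedAddCommGroup E] {T : ℝ} (hT : 0 ≤ T)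
    {f : ℝ → E} (hf : MemLp f 2 (volume.restrict (Ioo 0 T))) : IntervalIntegrable f volume 0 T :=
  (intervalIntegrable_iff_integrableOn_Ioo_of_le hT).2 (hf.integrable (by norm_num))

lemma integral_congr_Ioo {E : Type*} [NormedAddCommGroup E] [NormedSpace ℝ E] {T : ℝ}
    {f f' : ℝ → E} (hff : ∀ s ∈ Ioo 0 T, f s = f' s) {t : ℝ} (ht : t ∈ Icc 0 T) :
    ∫ s in 0..t, f s = ∫ s in 0..t, f' s := by
  rw [intervalIntegral.integral_of_le ht.1, intervalIntegral.integral_of_le ht.1,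
    integral_Ioc_eq_integral_Ioo, integral_Ioc_eq_integral_Ioo]
  exact setIntegral_congr_fun measurableSet_Ioo fun s hs => hff s ⟨hs.1, hs.2.trans_le ht.2⟩

/-- The embedding of `W(0,T)` into `C([0,T]; H)`, with the energy identity. -/
theorem exists_continuous_representative {ι : V →L[ℝ] H} {T : ℝ}
    (hT : 0 < T) {v : ℝ → V} {g : ℝ → StrongDual ℝ V} {c : StrongDual ℝ V}
    (hv : MemLp v 2 (volume.restrict (Ioo 0 T))) (hg : MemLp g 2 (volume.restrict (Ioo 0 T)))
    (h : ∀ᵐ t ∂(volume.restrict (Ioo 0 T)), toDual ι (ι (v t)) = c + ∫ s in 0..t, g s) :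
    ∃ y : ℝ → H, ContinuousOn y (Icc 0 T) ∧
      (∀ᵐ t ∂(volume.restrict (Ioo 0 T)), y t = ι (v t)) ∧
      (∀ t ∈ Icc 0 T, toDual ι (y t) = c + ∫ s in 0..t, g s) ∧
      ∀ t ∈ Icc 0 T, ‖y t‖ ^ 2 - ‖y 0‖ ^ 2 = 2 * ∫ s in 0..t, g s (v s) := by
  -- Extension by zero makes `v` and `g` locally integrable on the whole line and changes nothing on
  -- `(0,T)`.
  have hloc : ∀ {E : Type _} [NormedAddCommGroup E] {f : ℝ → E},
      MemLp f 2 (volume.restrict (Ioo 0 T)) → LocallyIntegrable ((Ioo 0 T).indicator f) := by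
    intro E _ f hf
    have : IntegrableOn f (Ioo 0 T) := hf.integrable (by norm_num)
    exact ((integrable_indicator_iff measurableSet_Ioo).2 this).locallyIntegrable
  have hae : ∀ {E : Type _} [NormedAddCommGroup E] (f : ℝ → E),
      (Ioo 0 T).indicator f =ᵐ[volume.restrict (Ioo 0 T)] f := fun f =>
    indicator_ae_eq_restrict measurableSet_Ioo
  obtain ⟨y, hy1, hy2, hy3⟩ := exists_continuous_representative_of_locallyIntegrable ι hT (c := c)
    (hloc hv) (hloc hg) (hv.ae_eq (hae v).symm) (hg.ae_eq (hae g).symm) (by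
      filter_upwards [h, hae v, ae_restrict_mem measurableSet_Ioo] with t ht hvt htm
      rw [hvt, ht, integral_congr_Ioo (fun s hs => indicator_of_mem hs g)
        (Ioo_subset_Icc_self htm)])
  have hy2' : ∀ᵐ t ∂(volume.restrict (Ioo 0 T)), y t = ι (v t) := by
    filter_upwards [hy2, hae v] with t ht hvt
    rw [ht, hvt]
  refine ⟨y, hy1, hy2', ?_, ?_⟩
  · have hYc : ContinuousOn (fun t => c + ∫ s in 0..t, g s) (Icc 0 T) := by
      have := intervalIntegral.continuousOn_primitive_interval'
        (intervalIntegrable_of_memLp hT.le hg) (left_mem_uIcc)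
      rw [uIcc_of_le hT.le] at this
      exact continuousOn_const.add this
    -- Both sides are continuous on `[0,T]`, so equality almost everywhere becomes equality at every
    -- time.
    refine Measure.eqOn_Icc_of_ae_eq volume hT.ne ?_
      ((continuous_toDual ι).comp_continuousOn hy1) hYc
    rw [Filter.EventuallyEq, ← restrict_Ioo_eq_restrict_Icc]
    filter_upwards [hy2', h] with t h1 h2
    rw [← h2, ← h1]
  · intro t ht
    rw [hy3 t ht]
    congr 1
    exact integral_congr_Ioo (fun s hs => by rw [indicator_of_mem hs, indicator_of_mem hs]) ht

end Energy

/-! ### A priori bounds and the integrated state equation -/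

section State

open Filter Topology

/-- The differential form of Gronwall's lemma, applied to the primitive of `N`, whose derivative is
at most `K + L` times itself. `N` is extended continuously beyond `[0,T]` so that this primitive is
differentiable at the end points too. -/
lemma integral_le_gronwallBound {T K L : ℝ} (hT : 0 ≤ T) {N : ℝ → ℝ}
    (hN : ContinuousOn N (Icc 0 T)) (hN0 : ∀ t ∈ Icc 0 T, 0 ≤ N t)
    (h : ∀ t ∈ Icc 0 T, N t ≤ K + L * ∫ s in 0..t, N s) :
    ∫ s in 0..T, N s ≤ gronwallBound 0 L K T := by
  set M : ℝ → ℝ := IccExtend hT ((Icc 0 T).domRestrict N) with hM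
  have hMc : Continuous M := hN.domRestrict.Icc_extend'
  have hMN : ∀ t ∈ Icc 0 T, M t = N t := fun t ht => by
    rw [hM, IccExtend_of_mem hT _ ht, domRestrict_apply]
  have hint : ∀ t ∈ Icc 0 T, ∫ s in 0..t, M s = ∫ s in 0..t, N s := fun t ht =>
    integral_congr_Ioo (fun s hs => hMN s (Ioo_subset_Icc_self hs)) ht
  have hd : ∀ t, HasDerivAt (fun t => ∫ s in (0 : ℝ)..t, M s) (M t) t := fun t =>
    intervalIntegral.integral_hasDerivAt_right (hMc.intervalIntegrable _ _)
      (hMc.stronglyMeasurableAtFilter _ _) hMc.continuousAt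
  have hpos : ∀ t ∈ Icc 0 T, 0 ≤ ∫ s in 0..t, M s := fun t ht => by
    rw [hint t ht]
    exact intervalIntegral.integral_nonneg ht.1 fun s hs => hN0 s ⟨hs.1, hs.2.trans ht.2⟩
  have key := norm_le_gronwallBound_of_norm_deriv_right_le (a := 0) (b := T) (δ := 0) (K := L)
    (ε := K) (f := fun t => ∫ s in (0 : ℝ)..t, M s) (f' := M)
    (fun t _ => (hd t).continuousAt.continuousWithinAt)
    (fun t _ => (hd t).hasDerivWithinAt) (by simp) (fun t ht => by
      have ht' := Ico_subset_Icc_self ht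
      rw [Real.norm_of_nonneg (hpos t ht'), Real.norm_of_nonneg (by rw [hMN t ht']; exact hN0 t ht'),
        hMN t ht', hint t ht']
      linarith [h t ht']) T ⟨hT, le_rfl⟩
  have hT' : T ∈ Icc 0 T := ⟨hT, le_rfl⟩
  rw [sub_zero, Real.norm_of_nonneg (hpos T hT'), hint T hT'] at key
  exact key

variable {V H ω : Type*} [NormedAddCommGroup V] [InnerProductSpace ℝ V]
  [NormedAddCommGroup H] [InnerProductSpace ℝ H]
  [MeasurableSpace ω] {ϱ : Measure ω}
  {ι : V →L[ℝ] H} {a : V →L[ℝ] V →L[ℝ] ℝ} {B : Lp ℝ 2 ϱ →L[ℝ] StrongDual ℝ V}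
  {y₀ : H} {T : ℝ} {u : ℝ → Lp ℝ 2 ϱ} {y : ℝ → H}

/-- The restriction of a state to a shorter time interval is a state. -/
lemma IsState.mono {S : ℝ} (hST : S ≤ T) (hy : IsState ι a B y₀ T u y) :
    IsState ι a B y₀ S u y := by
  obtain ⟨hyc, hy0, v, g, hW, hyv, hg⟩ := hy
  have hsub : Ioo 0 S ⊆ Ioo 0 T := Ioo_subset_Ioo_right hST
  have hle : volume.restrict (Ioo 0 S) ≤ volume.restrict (Ioo 0 T) :=
    Measure.restrict_mono hsub le_rfl
  have hac := hle.absolutelyContinuous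
  refine ⟨hyc.mono (Icc_subset_Icc_right hST), hy0, v, g,
    ⟨hW.memLp.mono_measure hle, hW.memLp_deriv.mono_measure hle, ?_⟩, hac.ae_le hyv, hac.ae_le hg⟩
  intro φ h1 h2 h3
  have e := hW.hasWeakDeriv φ h1 h2 (h3.trans hsub)
  have hs : ∀ {f : ℝ → StrongDual ℝ V}, (∀ t, t ∉ tsupport φ → f t = 0) →
      ∫ t in Ioo 0 T, f t = ∫ t in Ioo 0 S, f t := by
    intro f hf
    rw [setIntegral_eq_integral_of_forall_compl_eq_zero fun t ht => hf t fun h => ht (hsub (h3 h)),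
      setIntegral_eq_integral_of_forall_compl_eq_zero fun t ht => hf t fun h => ht (h3 h)]
  rw [hs fun t ht => ?_, hs fun t ht => ?_] at e
  · exact e
  · rw [image_eq_zero_of_notMem_tsupport ht, zero_smul]
  · have : deriv φ t = 0 :=
      image_eq_zero_of_notMem_tsupport fun h => ht (tsupport_deriv_subset h)
    rw [this, zero_smul]

/-- The energy estimate: a bound for the state in `L²(0,T; V)` which depends only on the data and
on a bound of the control. -/
lemma exists_integral_sq_norm_le
    (hG : ∃ α₀ > (0 : ℝ), ∃ ω₀ ≥ (0 : ℝ), ∀ v : V, a v v + ω₀ * ‖ι v‖ ^ 2 ≥ α₀ * ‖v‖ ^ 2)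
    (B : Lp ℝ 2 ϱ →L[ℝ] StrongDual ℝ V) (y₀ : H) (M S : ℝ) :
    ∃ R : ℝ, ∀ T u y, ∀ v : ℝ → V, 0 < T → T ≤ S →
      (∀ᵐ t ∂(volume.restrict (Ioo 0 T)), ‖B (u t)‖ ≤ M) →
      ContinuousOn y (Icc 0 T) →
      MemLp u 2 (volume.restrict (Ioo 0 T)) → MemLp v 2 (volume.restrict (Ioo 0 T)) →
      (∀ᵐ t ∂(volume.restrict (Ioo 0 T)), y t = ι (v t)) →
      (∀ t ∈ Icc 0 T, ‖y t‖ ^ 2 - ‖y₀‖ ^ 2 = 2 * ∫ s in 0..t, (B (u s) - a (v s)) (v s)) →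
      ∫ t in Ioo 0 T, ‖v t‖ ^ 2 ≤ R := by
  obtain ⟨α, hα, ν, hν, hG⟩ := hG
  -- Gårding and `2 M ‖v‖ ≤ M² / α + α ‖v‖²` give `2 ⟨Bu - Av, v⟩ ≤ M² / α + 2 ν ‖y‖² - α ‖v‖²`.
  -- After integration, the data contribute `K`, and Gronwall bounds the `‖y‖²` term; all constants
  -- are taken at the common upper bound `S` of the times.
  set K : ℝ := ‖y₀‖ ^ 2 + M ^ 2 / α * S with hK
  refine ⟨(K + 2 * ν * gronwallBound 0 (2 * ν) K S) / α, ?_⟩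
  intro T u y v hT hTS huM hyc hu hv hyv hen
  have hK0 : 0 ≤ K := by
    have : 0 ≤ M ^ 2 / α * S := mul_nonneg (by positivity) (hT.le.trans hTS)
    positivity
  have hMT : M ^ 2 / α * T ≤ M ^ 2 / α * S := mul_le_mul_of_nonneg_left hTS (by positivity)
  have hNc : ContinuousOn (fun t => ‖y t‖ ^ 2) (Icc 0 T) := hyc.norm.pow 2
  have hg : MemLp (fun s => B (u s) - a (v s)) 2 (volume.restrict (Ioo 0 T)) :=
    (B.comp_memLp' hu).sub (a.comp_memLp' hv)
  have hIg := integrable_dual_apply hg hv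
  have hIv := integrable_sq_norm hv
  have hIy : Integrable (fun t => ‖y t‖ ^ 2) (volume.restrict (Ioo 0 T)) :=
    (hNc.integrableOn_Icc).mono_set Ioo_subset_Icc_self
  have hpt : ∀ᵐ s ∂(volume.restrict (Ioo 0 T)), 2 * (B (u s) - a (v s)) (v s) ≤
      M ^ 2 / α + (2 * ν) * ‖y s‖ ^ 2 - α * ‖v s‖ ^ 2 := by
    filter_upwards [huM, hyv] with s h1 h2
    rw [h2, sub_apply]
    have h3 : B (u s) (v s) ≤ ‖B (u s)‖ * ‖v s‖ := (le_abs_self _).trans ((B (u s)).le_opNorm _)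
    have h4 : ‖B (u s)‖ * ‖v s‖ ≤ M * ‖v s‖ := mul_le_mul_of_nonneg_right h1 (norm_nonneg _)
    have h5 := hG (v s)
    have h6 : 2 * (M * ‖v s‖) ≤ M ^ 2 / α + α * ‖v s‖ ^ 2 := by
      have : M ^ 2 / α + α * ‖v s‖ ^ 2 - 2 * (M * ‖v s‖) = (M - α * ‖v s‖) ^ 2 / α := by
        field_simp; ring
      have h7 : 0 ≤ (M - α * ‖v s‖) ^ 2 / α := by positivity
      linarith
    linarith
  have hest : ∀ t ∈ Icc 0 T, ‖y t‖ ^ 2 + α * ∫ s in Ioo 0 t, ‖v s‖ ^ 2 ≤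
      K + 2 * ν * ∫ s in 0..t, ‖y s‖ ^ 2 := by
    intro t ht
    have hle : volume.restrict (Ioo 0 t) ≤ volume.restrict (Ioo 0 T) :=
      Measure.restrict_mono (Ioo_subset_Ioo_right ht.2) le_rfl
    have e := hen t ht
    rw [intervalIntegral.integral_of_le ht.1, integral_Ioc_eq_integral_Ioo] at e
    rw [intervalIntegral.integral_of_le ht.1, integral_Ioc_eq_integral_Ioo]
    have hi1 := (integrable_const (μ := volume.restrict (Ioo 0 t)) (M ^ 2 / α))
    have hi2 := (hIy.mono_measure hle).const_mul (2 * ν)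
    have hi3 := (hIv.mono_measure hle).const_mul α
    have hmono := integral_mono_ae ((hIg.mono_measure hle).const_mul 2) ((hi1.add hi2).sub hi3)
      (hle.absolutelyContinuous.ae_le hpt)
    rw [integral_sub' (hi1.add hi2) hi3, integral_add' hi1 hi2, setIntegral_const] at hmono
    simp only [integral_const_mul, Measure.real, Real.volume_Ioo, sub_zero, ENNReal.toReal_ofReal ht.1,
      smul_eq_mul] at hmono
    have : t * (M ^ 2 / α) ≤ T * (M ^ 2 / α) := mul_le_mul_of_nonneg_right ht.2 (by positivity)
    linarith
  have hgr := integral_le_gronwallBound hT.le hNc (fun t _ => by positivity)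
    (K := K) (L := 2 * ν) fun t ht => by
      have h1 := hest t ht
      have h2 : 0 ≤ α * ∫ s in Ioo 0 t, ‖v s‖ ^ 2 :=
        mul_nonneg hα.le (integral_nonneg fun s => by positivity)
      linarith
  have hgm : gronwallBound 0 (2 * ν) K T ≤ gronwallBound 0 (2 * ν) K S :=
    gronwallBound_mono le_rfl hK0 (by positivity) hTS
  have h1 := hest T ⟨hT.le, le_rfl⟩
  have h2 : 2 * ν * ∫ s in 0..T, ‖y s‖ ^ 2 ≤ 2 * ν * gronwallBound 0 (2 * ν) K S :=
    mul_le_mul_of_nonneg_left (hgr.trans hgm) (by positivity)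
  rw [le_div_iff₀ hα]
  have h3 : 0 ≤ ‖y T‖ ^ 2 := by positivity
  linarith

variable [CompleteSpace V] [CompleteSpace H]

/-- The integrated state equation and the energy identity. -/
lemma IsState.exists_primitive (hT : 0 < T) (hy : IsState ι a B y₀ T u y)
    (hu : MemLp u 2 (volume.restrict (Ioo 0 T))) :
    ∃ v : ℝ → V, MemLp v 2 (volume.restrict (Ioo 0 T)) ∧
      (∀ᵐ t ∂(volume.restrict (Ioo 0 T)), y t = ι (v t)) ∧
      (∀ t ∈ Icc 0 T, toDual ι (y t) = toDual ι y₀ + ∫ s in 0..t, (B (u s) - a (v s))) ∧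
      ∀ t ∈ Icc 0 T, ‖y t‖ ^ 2 - ‖y₀‖ ^ 2 = 2 * ∫ s in 0..t, (B (u s) - a (v s)) (v s) := by
  obtain ⟨hyc, hy0, v, g, hW, hyv, hg⟩ := hy
  set g' : ℝ → StrongDual ℝ V := fun s => B (u s) - a (v s) with hg'
  have hgg' : ∀ᵐ t ∂(volume.restrict (Ioo 0 T)), g t = g' t := by
    filter_upwards [hg] with t ht
    simp only [hg', ← ht, add_sub_cancel_right]
  have hg'L : MemLp g' 2 (volume.restrict (Ioo 0 T)) :=
    (B.comp_memLp' hu).sub (a.comp_memLp' hW.memLp)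
  have hweak : HasWeakDerivOn T (fun t => toDual ι (ι (v t))) g' := by
    intro φ h1 h2 h3
    rw [hW.hasWeakDeriv φ h1 h2 h3]
    congr 1
    apply integral_congr_ae
    filter_upwards [hgg'] with t ht
    rw [ht]
  obtain ⟨c, hc⟩ := hweak.ae_eq_primitive hT
    (intervalIntegrable_of_memLp hT.le ((pivotEmbedding ι).comp_memLp' hW.memLp))
    (intervalIntegrable_of_memLp hT.le hg'L)
  obtain ⟨z, hz1, hz2, hz3, hz4⟩ := exists_continuous_representative hT hW.memLp hg'L hc
  have hyz : EqOn y z (Icc 0 T) := by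
    refine Measure.eqOn_Icc_of_ae_eq volume hT.ne ?_ hyc hz1
    rw [Filter.EventuallyEq, ← restrict_Ioo_eq_restrict_Icc]
    filter_upwards [hyv, hz2] with t h1 h2
    rw [h1, h2]
  have h0 : (0 : ℝ) ∈ Icc 0 T := ⟨le_rfl, hT.le⟩
  have hz0 : z 0 = y₀ := by rw [← hyz h0, hy0]
  have hc0 : c = toDual ι y₀ := by
    have := hz3 0 h0
    rw [hz0, intervalIntegral.integral_same, add_zero] at this
    exact this.symm
  refine ⟨v, hW.memLp, hyv, fun t ht => ?_, fun t ht => ?_⟩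
  · rw [hyz ht, hz3 t ht, hc0]
  · rw [hyz ht, ← hz0, hz4 t ht]

/-- A function in `L²(0,T; V)` that solves the integrated state equation yields a state. -/
lemma exists_isState_of_primitive (hι : DenseRange ι) (hT : 0 < T)
    (hu : MemLp u 2 (volume.restrict (Ioo 0 T))) {v : ℝ → V}
    (hv : MemLp v 2 (volume.restrict (Ioo 0 T)))
    (h : ∀ᵐ t ∂(volume.restrict (Ioo 0 T)),
      toDual ι (ι (v t)) = toDual ι y₀ + ∫ s in 0..t, (B (u s) - a (v s))) :
    ∃ y : ℝ → H, IsState ι a B y₀ T u y ∧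
      toDual ι (y T) = toDual ι y₀ + ∫ s in 0..T, (B (u s) - a (v s)) := by
  have hg : MemLp (fun s => B (u s) - a (v s)) 2 (volume.restrict (Ioo 0 T)) :=
    (B.comp_memLp' hu).sub (a.comp_memLp' hv)
  obtain ⟨y, hy1, hy2, hy3, -⟩ := exists_continuous_representative hT hv hg h
  refine ⟨y, ⟨hy1, toDual_injective hι ?_, v, fun s => B (u s) - a (v s), ⟨hv, hg, ?_⟩, hy2,
    ae_of_all _ fun t => sub_add_cancel _ _⟩, hy3 T ⟨hT.le, le_rfl⟩⟩
  · simpa using hy3 0 ⟨le_rfl, hT.le⟩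
  · exact HasWeakDerivOn.of_ae_eq_primitive hT.le (intervalIntegrable_of_memLp hT.le hg) h

end State

/-! ### Weak limits in Hilbert spaces without subsequences -/

section WeakCompactness

open Filter Topology

/-- Weak sequential compactness of bounded sequences, in terms of closed convex sets. -/
lemma exists_mem_of_eventually_mem_convex {E : Type*} [NormedAddCommGroup E]
    [InnerProductSpace ℝ E] [CompleteSpace E] {x : ℕ → E} {R : ℝ} (hx : ∀ n, ‖x n‖ ≤ R) :
    ∃ z, ∀ C : Set E, IsClosed C → Convex ℝ C → (∀ᶠ n in atTop, x n ∈ C) → z ∈ C := by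
  -- The elements of least norm in the closed convex hulls of the tails have increasing, bounded
  -- norms. The parallelogram law makes them Cauchy, and their limit plays the role of a weak limit.
  set K : ℕ → Set E := fun n => closure (convexHull ℝ (x '' Ici n)) with hK
  have hKc : ∀ n, Convex ℝ (K n) := fun n => (convex_convexHull ℝ _).closure
  have hxK : ∀ n, x n ∈ K n := fun n =>
    subset_closure (subset_convexHull ℝ _ (mem_image_of_mem x self_mem_Ici))
  have hanti : ∀ m n, m ≤ n → K n ⊆ K m := fun m n hmn =>
    closure_mono (convexHull_mono (image_mono (Ici_subset_Ici.2 hmn)))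
  have hmin : ∀ n, ∃ p ∈ K n, ∀ w ∈ K n, ‖p‖ ≤ ‖w‖ := by
    intro n
    obtain ⟨p, hp, hpe⟩ := exists_norm_eq_iInf_of_complete_convex ⟨_, hxK n⟩
      (isClosed_closure.isComplete) (hKc n) 0
    refine ⟨p, hp, fun w hw => ?_⟩
    have h1 : ⨅ w : K n, ‖(0 : E) - w‖ ≤ ‖(0 : E) - w‖ :=
      ciInf_le ⟨0, by rintro _ ⟨w, rfl⟩; exact norm_nonneg _⟩ (⟨w, hw⟩ : K n)
    rw [← hpe] at h1
    simpa using h1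
  choose p hp hpmin using hmin
  have hmono : Monotone fun n => ‖p n‖ ^ 2 := fun m n hmn => by
    have := hpmin m (p n) (hanti m n hmn (hp n))
    exact pow_le_pow_left₀ (norm_nonneg _) this 2
  have hbdd : BddAbove (range fun n => ‖p n‖ ^ 2) := by
    refine ⟨R ^ 2, ?_⟩
    rintro _ ⟨n, rfl⟩
    have := (hpmin n (x n) (hxK n)).trans (hx n)
    simp only
    gcongr
  set d := ⨆ n, ‖p n‖ ^ 2 with hd
  have hlim : Tendsto (fun n => ‖p n‖ ^ 2) atTop (𝓝 d) := tendsto_atTop_ciSup hmono hbdd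
  have hle : ∀ n, ‖p n‖ ^ 2 ≤ d := fun n => le_ciSup hbdd n
  have hcau : CauchySeq p := by
    refine cauchySeq_of_le_tendsto_0' (fun n => Real.sqrt (2 * (d - ‖p n‖ ^ 2))) ?_ ?_
    · intro n m hnm
      apply Real.le_sqrt_of_sq_le
      rw [dist_eq_norm]
      -- The midpoint stays in `K n`, so its norm is at least `‖p n‖`; hence `‖p n - p m‖² ≤ 2 (‖p
      -- m‖² - ‖p n‖²)`.
      have hmid : (1 / 2 : ℝ) • p n + (1 / 2 : ℝ) • p m ∈ K n :=
        hKc n (hp n) (hanti n m hnm (hp m)) (by norm_num) (by norm_num) (by norm_num)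
      have h1 := hpmin n _ hmid
      rw [← smul_add, norm_smul, Real.norm_of_nonneg (by norm_num)] at h1
      have h2 := parallelogram_law_with_norm ℝ (p n) (p m)
      have h3 : (2 * ‖p n‖) ^ 2 ≤ ‖p n + p m‖ ^ 2 := by
        gcongr
        linarith
      have h4 := hle m
      nlinarith
    · have : Tendsto (fun n => Real.sqrt (2 * (d - ‖p n‖ ^ 2))) atTop
          (𝓝 (Real.sqrt (2 * (d - d)))) :=
        ((hlim.const_sub d).const_mul 2).sqrt
      simpa using this
  obtain ⟨z, hz⟩ := cauchySeq_tendsto_of_complete hcau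
  refine ⟨z, fun C hC hconv hev => hC.mem_of_tendsto hz ?_⟩
  obtain ⟨N, hN⟩ := eventually_atTop.1 hev
  filter_upwards [eventually_ge_atTop N] with n hn
  refine closure_minimal (convexHull_min ?_ hconv) hC (hp n)
  rintro _ ⟨k, hk, rfl⟩
  exact hN k (hn.trans hk)

/-- The product carries the maximum norm, which is not Hilbertian. Boundedness, closedness and
convexity are transported along the isomorphism with the `ℓ²` product. -/
lemma exists_mem_of_eventually_mem_convex_prod {E₁ E₂ E₃ : Type*}
    [NormedAddCommGroup E₁] [InnerProductSpace ℝ E₁] [CompleteSpace E₁]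
    [NormedAddCommGroup E₂] [InnerProductSpace ℝ E₂] [CompleteSpace E₂]
    [NormedAddCommGroup E₃] [InnerProductSpace ℝ E₃] [CompleteSpace E₃]
    {x : ℕ → E₁ × E₂ × E₃} {R : ℝ} (hx : ∀ n, ‖x n‖ ≤ R) :
    ∃ z, ∀ C : Set (E₁ × E₂ × E₃), IsClosed C → Convex ℝ C → (∀ᶠ n in atTop, x n ∈ C) →
      z ∈ C := by
  let e₁ := WithLp.prodContinuousLinearEquiv 2 ℝ E₂ E₃
  let e₂ := WithLp.prodContinuousLinearEquiv 2 ℝ E₁ (WithLp 2 (E₂ × E₃))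
  let e : WithLp 2 (E₁ × WithLp 2 (E₂ × E₃)) ≃L[ℝ] E₁ × E₂ × E₃ :=
    e₂.trans ((ContinuousLinearEquiv.refl ℝ E₁).prodCongr e₁)
  let L : E₁ × E₂ × E₃ →L[ℝ] WithLp 2 (E₁ × WithLp 2 (E₂ × E₃)) := e.symm.toContinuousLinearMap
  have hb : ∀ n, ‖L (x n)‖ ≤ ‖L‖ * R := fun n =>
    (L.le_opNorm (x n)).trans (mul_le_mul_of_nonneg_left (hx n) (norm_nonneg _))
  obtain ⟨z, hz⟩ := exists_mem_of_eventually_mem_convex hb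
  refine ⟨e z, fun C hC hconv hev => hz (e ⁻¹' C) (hC.preimage e.continuous)
    (hconv.linear_preimage e.toLinearMap) ?_⟩
  filter_upwards [hev] with n hn
  change e (e.symm (x n)) ∈ C
  rwa [e.apply_symm_apply]

end WeakCompactness

/-! ### Closedness of reachability under limits of times and radii -/

section Closedness

open Filter Topology

lemma exists_subseq_tendsto_ae {α E : Type*} [MeasurableSpace α] {μ : Measure α}
    [NormedAddCommGroup E] {f : ℕ → Lp E 2 μ} {g : Lp E 2 μ} (h : Tendsto f atTop (𝓝 g)) :
    ∃ ns : ℕ → ℕ, StrictMono ns ∧ ∀ᵐ x ∂μ, Tendsto (fun i => f (ns i) x) atTop (𝓝 (g x)) :=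
  (tendstoInMeasure_of_tendsto_Lp h).exists_seq_tendsto_ae

section IntegralCLM

variable (E : Type*) [NormedAddCommGroup E] [NormedSpace ℝ E] [CompleteSpace E] (S : ℝ)

/-- The integral over `(0,t)` as a continuous linear map on `L²(0,S)`. -/
noncomputable def integralTo (t : ℝ) : Lp E 2 (volume.restrict (Ioo 0 S)) →L[ℝ] E :=
  (ContinuousLinearMap.lsmul ℝ ℝ).lpPairing (volume.restrict (Ioo 0 S)) 2 2
    (indicatorConstLp 2 (measurableSet_Ioo (a := 0) (b := t)) (measure_ne_top _ _) (1 : ℝ))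

variable {E S}

lemma integralTo_eq {t : ℝ} (ht : t ∈ Icc 0 S) (f : Lp E 2 (volume.restrict (Ioo 0 S))) :
    integralTo E S t f = ∫ s in 0..t, f s := by
  rw [integralTo, ContinuousLinearMap.lpPairing_eq_integral, intervalIntegral.integral_of_le ht.1,
    integral_Ioc_eq_integral_Ioo]
  have h1 : ∀ᵐ s ∂(volume.restrict (Ioo 0 S)),
      ContinuousLinearMap.lsmul ℝ ℝ ((indicatorConstLp 2 (measurableSet_Ioo (a := 0) (b := t))
        (measure_ne_top (volume.restrict (Ioo 0 S)) _) (1 : ℝ)) s) (f s) =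
      (Ioo 0 t).indicator f s := by
    filter_upwards [indicatorConstLp_coeFn (p := 2) (μ := volume.restrict (Ioo 0 S))
      (hs := measurableSet_Ioo (a := 0) (b := t)) (hμs := measure_ne_top _ _) (c := (1 : ℝ))]
      with s hs
    rw [hs]
    by_cases hm : s ∈ Ioo 0 t <;> simp [hm]
  rw [integral_congr_ae h1, integral_indicator measurableSet_Ioo,
    Measure.restrict_restrict measurableSet_Ioo,
    inter_eq_left.2 (Ioo_subset_Ioo_right ht.2)]

/-- The convergence is in operator norm, because the indicator of `(0,t)` depends continuously on
`t` in `L²`. On bounded sequences, a varying end time may therefore be replaced by its limit. -/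
lemma tendsto_integralTo {tn : ℕ → ℝ} {t : ℝ} (h : Tendsto tn atTop (𝓝 t)) :
    Tendsto (fun n => integralTo E S (tn n)) atTop (𝓝 (integralTo E S t)) := by
  refine (((ContinuousLinearMap.lsmul ℝ ℝ).lpPairing
    (volume.restrict (Ioo 0 S)) 2 2).continuous.tendsto _).comp
    (tendsto_indicatorConstLp_set (by norm_num) ?_)
  have hsub : ∀ a b : ℝ, symmDiff (Ioo 0 a) (Ioo 0 b) ⊆ uIcc a b := by
    intro a b x hx
    rw [mem_uIcc]
    rcases hx with ⟨h1, h2⟩ | ⟨h1, h2⟩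
    · exact Or.inr ⟨not_lt.1 fun h => h2 ⟨h1.1, h⟩, h1.2.le⟩
    · exact Or.inl ⟨not_lt.1 fun h => h2 ⟨h1.1, h⟩, h1.2.le⟩
  have hle : ∀ n, (volume.restrict (Ioo 0 S)) (symmDiff (Ioo 0 (tn n)) (Ioo 0 t)) ≤
      ENNReal.ofReal |t - tn n| := fun n =>
    (Measure.restrict_apply_le _ _).trans
      ((measure_mono (hsub _ _)).trans (by rw [uIcc, Real.volume_Icc, max_sub_min_eq_abs]))
  refine tendsto_of_tendsto_of_tendsto_of_le_of_le tendsto_const_nhds ?_ (fun n => zero_le) hle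
  have h1 : Tendsto (fun n => |t - tn n|) atTop (𝓝 |t - t|) := (h.const_sub t).abs
  have h2 := (ENNReal.continuous_ofReal.tendsto _).comp h1
  simpa [Function.comp_def] using h2

lemma tendsto_integralTo_sub_apply {tn : ℕ → ℝ} {t : ℝ} (h : Tendsto tn atTop (𝓝 t)) {R : ℝ}
    {f : ℕ → Lp E 2 (volume.restrict (Ioo 0 S))} (hf : ∀ n, ‖f n‖ ≤ R) :
    Tendsto (fun n => integralTo E S (tn n) (f n) - integralTo E S t (f n)) atTop (𝓝 0) := by
  have h1 : Tendsto (fun n => ‖integralTo E S (tn n) - integralTo E S t‖ * R) atTop (𝓝 0) := by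
    simpa using
      (tendsto_iff_norm_sub_tendsto_zero.1 (tendsto_integralTo (E := E) (S := S) h)).mul_const R
  refine squeeze_zero_norm (fun n => ?_) h1
  rw [← sub_apply]
  exact (ContinuousLinearMap.le_opNorm _ _).trans
    (mul_le_mul_of_nonneg_left (hf n) (norm_nonneg _))

end IntegralCLM

variable {V H ω : Type*} [NormedAddCommGroup V] [InnerProductSpace ℝ V]
  [NormedAddCommGroup H] [InnerProductSpace ℝ H] [MeasurableSpace ω] {ϱ : Measure ω}

lemma convex_Uad (ua ub : Lp ℝ ⊤ ϱ) : Convex ℝ (Uad ua ub) := by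
  intro u hu w hw α β hα hβ hαβ
  filter_upwards [hu, hw, Lp.coeFn_add (α • u) (β • w), Lp.coeFn_smul α u, Lp.coeFn_smul β w]
    with x h1 h2 h3 h4 h5
  rw [h3, Pi.add_apply, h4, h5]
  exact convex_Icc (ua x) (ub x) h1 h2 hα hβ hαβ

lemma isClosed_Uad (ua ub : Lp ℝ ⊤ ϱ) : IsClosed (Uad ua ub) := by
  apply IsSeqClosed.isClosed
  intro f g hf hg
  obtain ⟨ns, -, hae⟩ := exists_subseq_tendsto_ae hg
  filter_upwards [hae, ae_all_iff.2 hf] with x h1 h2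
  exact isClosed_Icc.mem_of_tendsto h1 (Eventually.of_forall fun i => h2 (ns i))

lemma convex_ae_mem {E : Type*} [NormedAddCommGroup E] [NormedSpace ℝ E] {μ : Measure ℝ}
    {C : Set E} (hC : Convex ℝ C) : Convex ℝ {f : Lp E 2 μ | ∀ᵐ t ∂μ, f t ∈ C} := by
  intro u hu w hw α β hα hβ hαβ
  filter_upwards [hu, hw, Lp.coeFn_add (α • u) (β • w), Lp.coeFn_smul α u, Lp.coeFn_smul β w]
    with x h1 h2 h3 h4 h5
  rw [h3, Pi.add_apply, h4, h5]
  exact hC h1 h2 hα hβ hαβ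

lemma isClosed_ae_mem {E : Type*} [NormedAddCommGroup E] {μ : Measure ℝ}
    {C : Set E} (hC : IsClosed C) : IsClosed {f : Lp E 2 μ | ∀ᵐ t ∂μ, f t ∈ C} := by
  apply IsSeqClosed.isClosed
  intro f g hf hg
  obtain ⟨ns, -, hae⟩ := exists_subseq_tendsto_ae hg
  filter_upwards [hae, ae_all_iff.2 hf] with x h1 h2
  exact hC.mem_of_tendsto h1 (Eventually.of_forall fun i => h2 (ns i))

lemma toDual_add (ι : V →L[ℝ] H) (h k : H) : toDual ι (h + k) = toDual ι h + toDual ι k := by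
  ext v; simp [inner_add_left]

lemma toDual_smul (ι : V →L[ℝ] H) (c : ℝ) (h : H) : toDual ι (c • h) = c • toDual ι h := by
  ext v; simp [inner_smul_left]

variable [CompleteSpace V] (ι : V →L[ℝ] H) (a : V →L[ℝ] V →L[ℝ] ℝ)
  (B : Lp ℝ 2 ϱ →L[ℝ] StrongDual ℝ V) (S : ℝ)

/-- The integral `∫₀ᵗ (B u - A v) ds` as a continuous linear map of `(v, u)`. -/
noncomputable def integratedForce (t : ℝ) :
    Lp V 2 (volume.restrict (Ioo 0 S)) × Lp (Lp ℝ 2 ϱ) 2 (volume.restrict (Ioo 0 S)) × H →L[ℝ]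
      StrongDual ℝ V :=
  (B.comp (integralTo _ S t)).comp ((ContinuousLinearMap.fst ℝ _ _).comp
    (ContinuousLinearMap.snd ℝ _ _)) -
  (a.comp (integralTo _ S t)).comp (ContinuousLinearMap.fst ℝ _ _)

lemma integratedForce_apply (t : ℝ)
    (p : Lp V 2 (volume.restrict (Ioo 0 S)) × Lp (Lp ℝ 2 ϱ) 2 (volume.restrict (Ioo 0 S)) × H) :
    integratedForce a B S t p = B (integralTo _ S t p.2.1) - a (integralTo _ S t p.1) := rfl

lemma integratedForce_eq {t : ℝ} (ht : t ∈ Icc 0 S)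
    {p : Lp V 2 (volume.restrict (Ioo 0 S)) × Lp (Lp ℝ 2 ϱ) 2 (volume.restrict (Ioo 0 S)) × H}
    {v : ℝ → V} {u : ℝ → Lp ℝ 2 ϱ}
    (hv : ∀ᵐ s ∂(volume.restrict (Ioo 0 S)), s < t → p.1 s = v s)
    (hu : ∀ᵐ s ∂(volume.restrict (Ioo 0 S)), s < t → p.2.1 s = u s) :
    integratedForce a B S t p = ∫ s in 0..t, (B (u s) - a (v s)) := by
  have hle : volume.restrict (Ioo 0 t) ≤ volume.restrict (Ioo 0 S) :=
    Measure.restrict_mono (Ioo_subset_Ioo_right ht.2) le_rfl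
  have hi : ∀ {E : Type _} [NormedAddCommGroup E] (f : Lp E 2 (volume.restrict (Ioo 0 S))),
      IntervalIntegrable f volume 0 t := fun f =>
    intervalIntegrable_of_memLp ht.1 ((Lp.memLp f).mono_measure hle)
  have hi' : IntervalIntegrable p.1 volume 0 t :=
    intervalIntegrable_of_memLp ht.1 ((Lp.memLp p.1).mono_measure hle)
  rw [integratedForce_apply, integralTo_eq ht, integralTo_eq ht,
    ← B.intervalIntegral_comp_comm (hi _), ← a.intervalIntegral_comp_comm hi']
  have e : ∫ s in 0..t, (B (u s) - a (v s)) = ∫ s in 0..t, (B (p.2.1 s) - a (p.1 s)) := by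
    rw [intervalIntegral.integral_of_le ht.1, intervalIntegral.integral_of_le ht.1,
      integral_Ioc_eq_integral_Ioo, integral_Ioc_eq_integral_Ioo]
    apply integral_congr_ae
    filter_upwards [hle.absolutelyContinuous.ae_le hv, hle.absolutelyContinuous.ae_le hu,
      ae_restrict_mem measurableSet_Ioo] with s h1 h2 h3
    rw [h1 h3.2, h2 h3.2]
  rw [e, intervalIntegral.integral_sub]
  · exact intervalIntegrable_of_memLp ht.1 (B.comp_memLp' ((Lp.memLp p.2.1).mono_measure hle))
  · exact intervalIntegrable_of_memLp ht.1 (a.comp_memLp' ((Lp.memLp p.1).mono_measure hle))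

/-- The pairs `(v, u)` that satisfy the integrated state equation on `(0,S')`. -/
def stateSet (y₀ : H) (S' : ℝ) :
    Set (Lp V 2 (volume.restrict (Ioo 0 S)) ×
      Lp (Lp ℝ 2 ϱ) 2 (volume.restrict (Ioo 0 S)) × H) :=
  {p | ∀ᵐ t ∂(volume.restrict (Ioo 0 S)), t < S' →
    pivotEmbedding ι (p.1 t) = toDual ι y₀ + integratedForce a B S t p}

lemma convex_stateSet (y₀ : H) (S' : ℝ) : Convex ℝ (stateSet ι a B S y₀ S') := by
  intro p hp q hq α β hα hβ hαβ
  filter_upwards [hp, hq, Lp.coeFn_add (α • p.1) (β • q.1), Lp.coeFn_smul α p.1,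
    Lp.coeFn_smul β q.1] with t h1 h2 h3 h4 h5 ht
  have e : (α • p + β • q).1 t = α • p.1 t + β • q.1 t := by
    rw [Prod.fst_add, Prod.smul_fst, Prod.smul_fst, h3, Pi.add_apply, h4, h5]
    rfl
  rw [e, map_add, map_add, map_smul, map_smul, map_smul, map_smul, h1 ht, h2 ht, smul_add, smul_add]
  have : toDual ι y₀ = α • toDual ι y₀ + β • toDual ι y₀ := by rw [← add_smul, hαβ, one_smul]
  nth_rewrite 3 [this]
  abel

lemma isClosed_stateSet (y₀ : H) (S' : ℝ) : IsClosed (stateSet ι a B S y₀ S') := by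
  apply IsSeqClosed.isClosed
  intro f g hf hg
  obtain ⟨ns, hns, hae⟩ := exists_subseq_tendsto_ae ((continuous_fst.tendsto g).comp hg)
  filter_upwards [hae, ae_all_iff.2 hf] with t h1 h2 ht
  refine tendsto_nhds_unique (((pivotEmbedding ι).continuous.tendsto _).comp h1) ?_
  refine Tendsto.congr (fun i => (h2 (ns i) ht).symm) ?_
  exact ((((integratedForce a B S t).continuous.tendsto g).comp
    (hg.comp hns.tendsto_atTop))).const_add _

variable {a B S} in
lemma tendsto_integratedForce_sub_apply {tn : ℕ → ℝ} {t : ℝ} (h : Tendsto tn atTop (𝓝 t)) {R : ℝ}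
    {x : ℕ → Lp V 2 (volume.restrict (Ioo 0 S)) ×
      Lp (Lp ℝ 2 ϱ) 2 (volume.restrict (Ioo 0 S)) × H} (hx : ∀ n, ‖x n‖ ≤ R) :
    Tendsto (fun n => integratedForce a B S (tn n) (x n) - integratedForce a B S t (x n)) atTop
      (𝓝 0) := by
  have h1 := tendsto_integralTo_sub_apply h (f := fun n => (x n).1)
    fun n => (norm_fst_le (x n)).trans (hx n)
  have h2 := tendsto_integralTo_sub_apply h (f := fun n => (x n).2.1)
    fun n => ((norm_fst_le (x n).2).trans (norm_snd_le (x n))).trans (hx n)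
  have h3 := ((B.continuous.tendsto _).comp h2).sub ((a.continuous.tendsto _).comp h1)
  rw [map_zero, map_zero, sub_zero] at h3
  refine h3.congr fun n => ?_
  simp only [Function.comp_apply, integratedForce_apply, map_sub]
  abel

/-- The triples `(v, u, z)` for which `z` is the terminal value at time `t` up to an error `ε`. -/
def terminalSet (y₀ : H) (t ε : ℝ) :
    Set (Lp V 2 (volume.restrict (Ioo 0 S)) ×
      Lp (Lp ℝ 2 ϱ) 2 (volume.restrict (Ioo 0 S)) × H) :=
  {p | ‖toDual ι p.2.2 - (toDual ι y₀ + integratedForce a B S t p)‖ ≤ ε}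

lemma isClosed_terminalSet (y₀ : H) (t ε : ℝ) : IsClosed (terminalSet ι a B S y₀ t ε) :=
  isClosed_le (((continuous_toDual ι).comp (continuous_snd.comp continuous_snd)).sub
    (continuous_const.add (integratedForce a B S t).continuous)).norm continuous_const

lemma convex_terminalSet (y₀ : H) (t ε : ℝ) : Convex ℝ (terminalSet ι a B S y₀ t ε) := by
  intro p hp q hq α β hα hβ hαβ
  have e : toDual ι (α • p + β • q).2.2 - (toDual ι y₀ + integratedForce a B S t (α • p + β • q)) =
      α • (toDual ι p.2.2 - (toDual ι y₀ + integratedForce a B S t p)) +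
      β • (toDual ι q.2.2 - (toDual ι y₀ + integratedForce a B S t q)) := by
    have : toDual ι y₀ = α • toDual ι y₀ + β • toDual ι y₀ := by rw [← add_smul, hαβ, one_smul]
    rw [map_add, map_smul, map_smul, Prod.snd_add, Prod.snd_add, Prod.smul_snd, Prod.smul_snd,
      Prod.smul_snd, Prod.smul_snd, toDual_add, toDual_smul, toDual_smul]
    nth_rewrite 1 [this]
    simp only [smul_sub, smul_add]
    abel
  change ‖_‖ ≤ ε
  rw [e]
  have h := convex_closedBall (0 : StrongDual ℝ V) ε (mem_closedBall_zero_iff.2 hp)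
    (mem_closedBall_zero_iff.2 hq) hα hβ hαβ
  exact mem_closedBall_zero_iff.1 h

variable {ι a B} [CompleteSpace H]

/-- If targets of radius `r n → r` can be reached at times `T n → T`, then the target of radius `r`
can be reached at time `T`. -/
theorem mem_feasibleTimes_of_tendsto (hι : DenseRange ι)
    (hG : ∃ α₀ > (0 : ℝ), ∃ ω₀ ≥ (0 : ℝ), ∀ v : V, a v v + ω₀ * ‖ι v‖ ^ 2 ≥ α₀ * ‖v‖ ^ 2)
    {ua ub : Lp ℝ ⊤ ϱ} (hbdd : Bornology.IsBounded (Uad ua ub)) {y₀ y_d : H}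
    {Tn rn : ℕ → ℝ} {T r : ℝ} (hTn : Tendsto Tn atTop (𝓝 T)) (hrn : Tendsto rn atTop (𝓝 r))
    (h : ∀ n, Tn n ∈ feasibleTimes ι a B ua ub y₀ y_d (rn n)) :
    (0 < T ∧ T ∈ feasibleTimes ι a B ua ub y₀ y_d r) ∨ (T = 0 ∧ ‖y₀ - y_d‖ ≤ r) := by
  choose hTpos u hu y hy hyr using h
  choose v hvL hyv hmild hen using fun n => (hy n).exists_primitive (hTpos n) (hu n).1
  obtain ⟨S, hS⟩ : ∃ S, ∀ n, Tn n ≤ S := by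
    obtain ⟨S, hS⟩ := hTn.bddAbove_range
    exact ⟨S, fun n => hS (mem_range_self n)⟩
  have hT0 : 0 ≤ T := ge_of_tendsto' hTn fun n => (hTpos n).le
  have hTS : T ≤ S := le_of_tendsto' hTn hS
  obtain ⟨M, hM⟩ := hbdd.exists_norm_le
  obtain ⟨u₀, hu₀⟩ : (Uad ua ub).Nonempty := by
    have : (ae (volume.restrict (Ioo 0 (Tn 0)))).NeBot := by
      rw [ae_restrict_neBot]
      simp [hTpos 0]
    obtain ⟨t, ht⟩ := (hu 0).2.exists
    exact ⟨_, ht⟩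
  have hM0 : 0 ≤ M := (norm_nonneg _).trans (hM u₀ hu₀)
  obtain ⟨R, hR⟩ := exists_integral_sq_norm_le hG B y₀ (‖B‖ * M) S
  have hvR : ∀ n, ∫ t in Ioo 0 (Tn n), ‖v n t‖ ^ 2 ≤ R := fun n =>
    hR (Tn n) (u n) (y n) (v n) (hTpos n) (hS n) (by
      filter_upwards [(hu n).2] with t ht
      exact (B.le_opNorm _).trans (mul_le_mul_of_nonneg_left (hM _ ht) (norm_nonneg _)))
      (hy n).1 (hu n).1 (hvL n) (hyv n) (hen n)
  set μ := volume.restrict (Ioo 0 S) with hμ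
  have hres : ∀ n, μ.restrict (Ioo 0 (Tn n)) = volume.restrict (Ioo 0 (Tn n)) := fun n => by
    rw [hμ, Measure.restrict_restrict measurableSet_Ioo,
      inter_eq_left.2 (Ioo_subset_Ioo_right (hS n))]
  -- All data are moved to the common interval `(0,S)`: states are extended by zero, controls by the
  -- fixed admissible value `u₀`, which preserves the constraint. The state equation is only used
  -- before `T n`.
  set v' : ℕ → ℝ → V := fun n => (Ioo 0 (Tn n)).indicator (v n) with hv'
  have hv'L : ∀ n, MemLp (v' n) 2 μ := fun n => by
    rw [hv', memLp_indicator_iff_restrict measurableSet_Ioo, hres]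
    exact hvL n
  set u' : ℕ → ℝ → Lp ℝ 2 ϱ := fun n => (Ioo 0 (Tn n)).piecewise (u n) fun _ => u₀ with hu'
  have hu'L : ∀ n, MemLp (u' n) 2 μ := fun n => by
    refine MemLp.piecewise measurableSet_Ioo ?_ (memLp_const _)
    rw [hres]
    exact (hu n).1
  have hu'U : ∀ n, ∀ᵐ t ∂μ, u' n t ∈ Uad ua ub := fun n => by
    have h1 := (hu n).2
    rw [ae_restrict_iff' measurableSet_Ioo] at h1
    refine ae_restrict_of_ae ?_
    filter_upwards [h1] with t ht
    by_cases hm : t ∈ Ioo 0 (Tn n)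
    · simpa [hu', hm] using ht hm
    · simpa [hu', hm] using hu₀
  set x : ℕ → Lp V 2 μ × Lp (Lp ℝ 2 ϱ) 2 μ × H := fun n =>
    ((hv'L n).toLp (v' n), (hu'L n).toLp (u' n), y n (Tn n)) with hx
  obtain ⟨Rr, hRr⟩ : ∃ Rr, ∀ n, rn n ≤ Rr := by
    obtain ⟨Rr, hRr⟩ := hrn.bddAbove_range
    exact ⟨Rr, fun n => hRr (mem_range_self n)⟩
  obtain ⟨R', hxR⟩ : ∃ R', ∀ n, ‖x n‖ ≤ R' := by
    refine ⟨max (Real.sqrt R)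
      (max ((measureUnivNNReal μ : ℝ) ^ (2 : ℝ≥0∞).toReal⁻¹ * M) (Rr + ‖y_d‖)), fun n => ?_⟩
    refine max_le_max ?_ (max_le_max ?_ ?_)
    · apply Real.le_sqrt_of_sq_le
      rw [sq_norm_toLp]
      refine le_trans (le_of_eq ?_) (hvR n)
      rw [← hres n, ← integral_indicator (f := fun t => ‖v n t‖ ^ 2) measurableSet_Ioo]
      apply integral_congr_ae
      refine ae_of_all _ fun t => ?_
      by_cases hm : t ∈ Ioo 0 (Tn n) <;> simp [hv', hm]
    · apply Lp.norm_le_of_ae_bound hM0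
      filter_upwards [hu'U n, (hu'L n).coeFn_toLp] with t h1 h2
      rw [h2]
      exact hM _ h1
    · calc ‖y n (Tn n)‖ = ‖(y n (Tn n) - y_d) + y_d‖ := by rw [sub_add_cancel]
        _ ≤ ‖y n (Tn n) - y_d‖ + ‖y_d‖ := norm_add_le _ _
        _ ≤ Rr + ‖y_d‖ := by gcongr; exact (hyr n).trans (hRr n)
  have hv'eq : ∀ n t, t ≤ Tn n → ∀ᵐ s ∂μ, s < t → (x n).1 s = v n s := fun n t ht => by
    filter_upwards [(hv'L n).coeFn_toLp, ae_restrict_mem measurableSet_Ioo] with s h1 h2 h3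
    have hm : s ∈ Ioo 0 (Tn n) := ⟨h2.1, h3.trans_le ht⟩
    rw [hx, h1]
    simp [hv', hm]
  have hu'eq : ∀ n t, t ≤ Tn n → ∀ᵐ s ∂μ, s < t → (x n).2.1 s = u n s := fun n t ht => by
    filter_upwards [(hu'L n).coeFn_toLp, ae_restrict_mem measurableSet_Ioo] with s h1 h2 h3
    have hm : s ∈ Ioo 0 (Tn n) := ⟨h2.1, h3.trans_le ht⟩
    rw [hx, h1]
    simp [hu', hm]
  have hforce : ∀ n, ∀ t ∈ Icc 0 (Tn n),
      toDual ι (y n t) = toDual ι y₀ + integratedForce a B S t (x n) := fun n t ht => by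
    rw [integratedForce_eq a B S ⟨ht.1, ht.2.trans (hS n)⟩ (hv'eq n t ht.2) (hu'eq n t ht.2)]
    exact hmild n t ht
  obtain ⟨p, hp⟩ := exists_mem_of_eventually_mem_convex_prod hxR
  have hpU : ∀ᵐ t ∂μ, p.2.1 t ∈ Uad ua ub := by
    refine hp {p | ∀ᵐ t ∂μ, p.2.1 t ∈ Uad ua ub}
      ((isClosed_ae_mem (isClosed_Uad ua ub)).preimage (continuous_fst.comp continuous_snd))
      ((convex_ae_mem (convex_Uad ua ub)).linear_preimage
        ((LinearMap.fst ℝ _ _).comp (LinearMap.snd ℝ _ _))) (Eventually.of_forall fun n => ?_)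
    filter_upwards [hu'U n, (hu'L n).coeFn_toLp] with t h1 h2
    rw [hx, h2]
    exact h1
  -- `T n` may be smaller than `T`, so the state equation holds eventually only on `(0,S')` with `S'
  -- < T`.
  have hpS : ∀ S' < T, p ∈ stateSet ι a B S y₀ S' := fun S' hS' => by
    refine hp _ (isClosed_stateSet ι a B S y₀ S') (convex_stateSet ι a B S y₀ S') ?_
    filter_upwards [hTn.eventually (lt_mem_nhds hS')] with n hn
    have h1 := hyv n
    rw [ae_restrict_iff' measurableSet_Ioo] at h1
    filter_upwards [hv'eq n (Tn n) le_rfl, ae_restrict_of_ae h1,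
      ae_restrict_mem measurableSet_Ioo] with t h2 h3 h4 h5
    have h6 : t < Tn n := h5.trans hn
    rw [h2 h6, pivotEmbedding_apply, ← h3 ⟨h4.1, h6⟩]
    exact hforce n t ⟨h4.1.le, h6.le⟩
  have hpr : ‖p.2.2 - y_d‖ ≤ r := by
    refine le_of_forall_pos_le_add fun ε hε => ?_
    have : p ∈ {p : Lp V 2 μ × Lp (Lp ℝ 2 ϱ) 2 μ × H | p.2.2 ∈ Metric.closedBall y_d (r + ε)} := by
      refine hp _ (Metric.isClosed_closedBall.preimage (continuous_snd.comp continuous_snd))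
        ((convex_closedBall y_d (r + ε)).linear_preimage
          ((LinearMap.snd ℝ _ _).comp (LinearMap.snd ℝ _ _))) ?_
      filter_upwards [hrn.eventually (gt_mem_nhds (lt_add_of_pos_right r hε))] with n hn
      refine mem_closedBall_iff_norm.2 ?_
      exact (hyr n).trans hn.le
    exact mem_closedBall_iff_norm.1 this
  have hpT : toDual ι p.2.2 = toDual ι y₀ + integratedForce a B S T p := by
    rw [← sub_eq_zero, ← norm_le_zero_iff]
    refine le_of_forall_pos_le_add fun ε hε => ?_
    rw [zero_add]
    -- The terminal condition is known at `T n`, not at `T`. The tolerance `ε` absorbs the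
    -- difference and keeps the condition closed, convex and eventually satisfied.
    refine hp _ (isClosed_terminalSet ι a B S y₀ T ε) (convex_terminalSet ι a B S y₀ T ε) ?_
    have h0 := tendsto_zero_iff_norm_tendsto_zero.1
      (tendsto_integratedForce_sub_apply (a := a) (B := B) hTn hxR)
    filter_upwards [h0.eventually (gt_mem_nhds hε)] with n hn
    have h1 := hforce n (Tn n) ⟨(hTpos n).le, le_rfl⟩
    change ‖toDual ι (y n (Tn n)) - _‖ ≤ ε
    rw [h1, add_sub_add_left_eq_sub]
    exact hn.le
  have hpforce : ∀ t ∈ Icc 0 T, integratedForce a B S t p =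
      ∫ s in 0..t, (B (p.2.1 s) - a (p.1 s)) := fun t ht =>
    integratedForce_eq a B S ⟨ht.1, ht.2.trans hTS⟩ (ae_of_all _ fun _ _ => rfl)
      (ae_of_all _ fun _ _ => rfl)
  rcases hT0.eq_or_lt with rfl | hT0
  · right
    refine ⟨rfl, ?_⟩
    rw [hpforce 0 ⟨le_rfl, le_rfl⟩, intervalIntegral.integral_same, add_zero] at hpT
    rwa [← toDual_injective hι hpT]
  · left
    have hle : volume.restrict (Ioo 0 T) ≤ μ :=
      Measure.restrict_mono (Ioo_subset_Ioo_right hTS) le_rfl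
    have hpu : MemLp p.2.1 2 (volume.restrict (Ioo 0 T)) := (Lp.memLp p.2.1).mono_measure hle
    have hpv : MemLp p.1 2 (volume.restrict (Ioo 0 T)) := (Lp.memLp p.1).mono_measure hle
    obtain ⟨z, hz, hzT⟩ := exists_isState_of_primitive (B := B) (a := a) (y₀ := y₀) hι hT0 hpu hpv
      (by
        -- The intervals `(0, T - 1 / (k + 1))` exhaust `(0,T)`; countably many of them keep the
        -- null sets under control.
        have hall : ∀ᵐ t ∂μ, ∀ k : ℕ, t < T - 1 / ((k : ℝ) + 1) →
            pivotEmbedding ι (p.1 t) = toDual ι y₀ + integratedForce a B S t p :=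
          ae_all_iff.2 fun k => hpS _ (sub_lt_self T (by positivity))
        filter_upwards [hle.absolutelyContinuous.ae_le hall, ae_restrict_mem measurableSet_Ioo]
          with t h1 h2
        obtain ⟨k, hk⟩ := exists_nat_one_div_lt (sub_pos.2 h2.2)
        rw [← hpforce t (Ioo_subset_Icc_self h2)]
        exact h1 k (by linarith))
    refine ⟨hT0, hT0, p.2.1, ⟨hpu, hle.absolutelyContinuous.ae_le hpU⟩, z, hz, ?_⟩
    have : z T = p.2.2 := by
      apply toDual_injective hι
      rw [hzT, hpT, hpforce T ⟨hT0.le, le_rfl⟩]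
    rwa [this]

end Closedness

/-! ### The minimal time: attainment, monotonicity, semicontinuity -/

section MinimalTime

open Filter Topology

variable {V H ω : Type*} [NormedAddCommGroup V] [InnerProductSpace ℝ V]
  [NormedAddCommGroup H] [InnerProductSpace ℝ H] [MeasurableSpace ω] {ϱ : Measure ω}
  {ι : V →L[ℝ] H} {a : V →L[ℝ] V →L[ℝ] ℝ} {B : Lp ℝ 2 ϱ →L[ℝ] StrongDual ℝ V}
  {ua ub : Lp ℝ ⊤ ϱ} {y₀ y_d : H} {r δ₀ : ℝ}

lemma feasibleTimes_mono {s : ℝ} (hrs : r ≤ s) :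
    feasibleTimes ι a B ua ub y₀ y_d r ⊆ feasibleTimes ι a B ua ub y₀ y_d s := by
  rintro T ⟨hT, u, hu, y, hy, hyr⟩
  exact ⟨hT, u, hu, y, hy, hyr.trans hrs⟩

lemma UadOn.mono {S T : ℝ} (hST : S ≤ T) {u : ℝ → Lp ℝ 2 ϱ} (hu : u ∈ UadOn ua ub T) :
    u ∈ UadOn ua ub S := by
  have hle : volume.restrict (Ioo 0 S) ≤ volume.restrict (Ioo 0 T) :=
    Measure.restrict_mono (Ioo_subset_Ioo_right hST) le_rfl
  exact ⟨hu.1.mono_measure hle, hle.absolutelyContinuous.ae_le hu.2⟩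

/-- A larger target is reached strictly earlier. -/
lemma exists_lt_mem_feasibleTimes {s T : ℝ} (hrs : r < s)
    (hT : T ∈ feasibleTimes ι a B ua ub y₀ y_d r) :
    ∃ t < T, t ∈ feasibleTimes ι a B ua ub y₀ y_d s := by
  obtain ⟨hT, u, hu, y, hy, hyr⟩ := hT
  -- The slack `s - r` and left continuity of the distance at `T` leave room to stop the same
  -- trajectory earlier.
  have hc : ContinuousWithinAt (fun t => ‖y t - y_d‖) (Icc 0 T) T :=
    ((hy.1.sub continuousOn_const).norm) T ⟨hT.le, le_rfl⟩
  have hc' : Tendsto (fun t => ‖y t - y_d‖) (𝓝[Ioo 0 T] T) (𝓝 ‖y T - y_d‖) :=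
    hc.mono Ioo_subset_Icc_self
  have : (𝓝[Ioo 0 T] T).NeBot := right_nhdsWithin_Ioo_neBot hT
  obtain ⟨t, ht, htm⟩ :=
    ((hc'.eventually (gt_mem_nhds (hyr.trans_lt hrs))).and self_mem_nhdsWithin).exists
  exact ⟨t, htm.2, htm.1, u, UadOn.mono htm.2.le hu, y, hy.mono htm.2.le, ht.le⟩

lemma minTime_le {T δ : ℝ} (hT : T ∈ feasibleTimes ι a B ua ub y₀ y_d (δ₀ + δ)) :
    minTime ι a B ua ub y₀ y_d δ₀ δ ≤ ENNReal.ofReal T :=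
  iInf₂_le T hT

lemma minTime_antitone : Antitone (minTime ι a B ua ub y₀ y_d δ₀) := fun δ δ' h =>
  le_iInf₂ fun _ hT => minTime_le (feasibleTimes_mono (by linarith) hT)

variable [CompleteSpace V] [CompleteSpace H]

/-- The minimal time is attained, as long as the initial state is outside the target. -/
lemma exists_minTime_eq (hι : DenseRange ι)
    (hG : ∃ α₀ > (0 : ℝ), ∃ ω₀ ≥ (0 : ℝ), ∀ v : V, a v v + ω₀ * ‖ι v‖ ^ 2 ≥ α₀ * ‖v‖ ^ 2)
    (hbdd : Bornology.IsBounded (Uad ua ub)) {δ : ℝ}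
    (hne : (feasibleTimes ι a B ua ub y₀ y_d (δ₀ + δ)).Nonempty) (hδ : δ₀ + δ < ‖y₀ - y_d‖) :
    ∃ T ∈ feasibleTimes ι a B ua ub y₀ y_d (δ₀ + δ),
      minTime ι a B ua ub y₀ y_d δ₀ δ = ENNReal.ofReal T := by
  set F := feasibleTimes ι a B ua ub y₀ y_d (δ₀ + δ) with hF
  have hbelow : BddBelow F := ⟨0, fun T hT => hT.1.le⟩
  -- A minimizing sequence with constant radius; the degenerate limit `T = 0` is excluded because
  -- `y₀` lies outside the ball.
  obtain ⟨Tn, -, hTn, hmem⟩ := exists_seq_tendsto_sInf hne hbelow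
  rcases mem_feasibleTimes_of_tendsto hι hG hbdd hTn tendsto_const_nhds hmem with
    ⟨-, h⟩ | ⟨-, h⟩
  · exact ⟨_, h, le_antisymm (minTime_le h)
      (le_iInf₂ fun T hT => ENNReal.ofReal_le_ofReal (csInf_le hbelow hT))⟩
  · exact absurd h (not_le.2 hδ)

/-- The minimal time is lower semicontinuous from the right. -/
lemma eventually_lt_minTime (hι : DenseRange ι)
    (hG : ∃ α₀ > (0 : ℝ), ∃ ω₀ ≥ (0 : ℝ), ∀ v : V, a v v + ω₀ * ‖ι v‖ ^ 2 ≥ α₀ * ‖v‖ ^ 2)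
    (hbdd : Bornology.IsBounded (Uad ua ub)) {δ : ℝ} (hδ : δ₀ + δ < ‖y₀ - y_d‖) {c : ℝ≥0∞}
    (hc : c < minTime ι a B ua ub y₀ y_d δ₀ δ) :
    ∀ᶠ δ' in 𝓝[≥] δ, c < minTime ι a B ua ub y₀ y_d δ₀ δ' := by
  obtain ⟨c', hcc', hc'⟩ := exists_between hc
  have hc'top : c' ≠ ⊤ := hc'.ne_top
  set τ : ℝ := c'.toReal with hτ
  -- Otherwise the radii `δ₀ + δ + 1 / (n + 1)` are all reached before `τ`. A convergent subsequence
  -- of these times makes `δ₀ + δ` reachable by time `τ`, although `c'` was chosen below the minimal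
  -- time.
  have key : ∃ N : ℕ, c < minTime ι a B ua ub y₀ y_d δ₀ (δ + 1 / ((N : ℝ) + 1)) := by
    by_contra! hcon
    have hex : ∀ n : ℕ, ∃ T ∈ feasibleTimes ι a B ua ub y₀ y_d (δ₀ + (δ + 1 / ((n : ℝ) + 1))),
        T < τ := by
      intro n
      have h1 := (hcon n).trans_lt hcc'
      simp only [minTime, iInf_lt_iff] at h1
      obtain ⟨T, hT, h2⟩ := h1
      exact ⟨T, hT, (ENNReal.ofReal_lt_iff_lt_toReal hT.1.le hc'top).1 h2⟩
    choose Tn hmem hTn using hex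
    obtain ⟨T, hT, φ, hφ, hlim⟩ := isCompact_Icc.tendsto_subseq
      (fun n => (⟨(hmem n).1.le, (hTn n).le⟩ : Tn n ∈ Icc 0 τ))
    have hr : Tendsto (fun n : ℕ => δ₀ + (δ + 1 / ((n : ℝ) + 1))) atTop (𝓝 (δ₀ + δ)) := by
      simpa using (tendsto_one_div_add_atTop_nhds_zero_nat.const_add δ).const_add δ₀
    rcases mem_feasibleTimes_of_tendsto hι hG hbdd hlim (hr.comp hφ.tendsto_atTop)
      (fun n => hmem (φ n)) with ⟨-, h⟩ | ⟨-, h⟩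
    · have h2 : ENNReal.ofReal T ≤ c' := by
        rw [← ENNReal.ofReal_toReal hc'top]
        exact ENNReal.ofReal_le_ofReal hT.2
      exact absurd ((minTime_le h).trans h2) (not_le.2 hc')
    · exact absurd h (not_le.2 hδ)
  obtain ⟨N, hN⟩ := key
  have hpos : (0 : ℝ) < 1 / ((N : ℝ) + 1) := by positivity
  filter_upwards [mem_nhdsWithin_of_mem_nhds (gt_mem_nhds (lt_add_of_pos_right δ hpos))] with δ' h
  exact hN.trans_le (minTime_antitone h.le)

end MinimalTime

end TimeOptimal

theorem mainTheorem3
    {V H ω : Type*}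
    [NormedAddCommGroup V] [InnerProductSpace ℝ V] [CompleteSpace V]
    [NormedAddCommGroup H] [InnerProductSpace ℝ H] [CompleteSpace H]
    [MeasurableSpace ω] (ϱ : Measure ω)
    -- the Gelfand triple `V ↪ H ≅ H* ↪ V*` with compact and dense embedding `V ↪ H`
    (ι : V →L[ℝ] H) (hι_inj : Function.Injective ι) (hι_dense : DenseRange ι)
    (hι_compact : IsCompactOperator ι)
    -- a continuous bilinear form with the Gårding inequality
    (a : V →L[ℝ] V →L[ℝ] ℝ)
    (hGarding : ∃ α₀ > (0 : ℝ), ∃ ω₀ ≥ (0 : ℝ),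
      ∀ v : V, a v v + ω₀ * ‖ι v‖ ^ 2 ≥ α₀ * ‖v‖ ^ 2)
    -- control operator, control bounds, initial state, desired state, radius of the target
    (B : Lp ℝ 2 ϱ →L[ℝ] StrongDual ℝ V)
    (ua ub : Lp ℝ ⊤ ϱ) (hab : ∀ᵐ x ∂ϱ, ua x < ub x)
    (hbdd : Bornology.IsBounded (TimeOptimal.Uad ua ub))
    (y₀ y_d : H) (δ₀ : ℝ) (hδ₀ : 0 < δ₀)
    -- the target is reachable, and not reached initially
    (hfeas : (TimeOptimal.feasibleTimes ι a B ua ub y₀ y_d δ₀).Nonempty)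
    (hy₀ : δ₀ < ‖y₀ - y_d‖) :
    (∀ δ ∈ Icc 0 (‖y₀ - y_d‖ - δ₀), TimeOptimal.minTime ι a B ua ub y₀ y_d δ₀ δ < ⊤) ∧
    StrictAntiOn (TimeOptimal.minTime ι a B ua ub y₀ y_d δ₀) (Icc 0 (‖y₀ - y_d‖ - δ₀)) ∧
    (∀ δ ∈ Icc 0 (‖y₀ - y_d‖ - δ₀),
      ContinuousWithinAt (TimeOptimal.minTime ι a B ua ub y₀ y_d δ₀)
        (Icc δ (‖y₀ - y_d‖ - δ₀)) δ) := by
  have hne : ∀ δ ∈ Icc 0 (‖y₀ - y_d‖ - δ₀),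
      (TimeOptimal.feasibleTimes ι a B ua ub y₀ y_d (δ₀ + δ)).Nonempty := fun δ hδ =>
    hfeas.mono (TimeOptimal.feasibleTimes_mono (le_add_of_nonneg_right hδ.1))
  refine ⟨fun δ hδ => ?_, fun δ hδ δ' hδ' hlt => ?_, fun δ hδ => ?_⟩
  · obtain ⟨T, hT⟩ := hne δ hδ
    exact (TimeOptimal.minTime_le hT).trans_lt ENNReal.ofReal_lt_top
  -- Even for `δ' = δ•`, attainment is needed only at the smaller `δ`, where `y₀` lies strictly
  -- outside the ball.
  · obtain ⟨T, hT, hTe⟩ := TimeOptimal.exists_minTime_eq hι_dense hGarding hbdd (hne δ hδ)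
      (by linarith [hδ'.2])
    obtain ⟨t, htT, ht⟩ := TimeOptimal.exists_lt_mem_feasibleTimes
      (s := δ₀ + δ') (by linarith) hT
    rw [hTe]
    exact (TimeOptimal.minTime_le ht).trans_lt ((ENNReal.ofReal_lt_ofReal_iff hT.1).2 htT)
  · rcases hδ.2.eq_or_lt with h | h
    · rw [← h, Icc_self]
      exact continuousWithinAt_singleton
    -- Lower bounds come from semicontinuity, upper bounds from monotonicity alone.
    · refine tendsto_order.2 ⟨fun c hc => ?_, fun c hc => ?_⟩
      · exact Filter.Eventually.filter_mono (nhdsWithin_mono _ Icc_subset_Ici_self)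
          (TimeOptimal.eventually_lt_minTime hι_dense hGarding hbdd (by linarith) hc)
      · filter_upwards [self_mem_nhdsWithin] with δ' hδ'
        exact (TimeOptimal.minTime_antitone hδ'.1).trans_lt hc
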